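/- Let $\mathrm{Sym}(N)$ be the space of real symmetric $N\times N$ matrices with the Frobenius inner product $\langle X,Y\rangle=\operatorname{tr}(XY)$, and let $A_1,\dots,A_m\in\mathrm{Sym}(N)$, $b\in\mathbb{R}^m$ and $$\mathcal S=\{P\in\mathrm{Sym}(N): P\succeq 0,\ \operatorname{tr}(A_kP)=b_k\ \text{for } k=1,\dots,m\}.$$ Assume that $\mathcal S$ is compact, that $A_1,\dots,A_m$ are linearly independent, that $m<\binom{N+1}{2}$, and that $\mathcal S$ has dimension exactly $\binom{N+1}{2}-m$. Let $\operatorname{vol}(\mathcal S)$ be its $\left(\binom{N+1}{2}-m\right)$-dimensional volume with respect to the Frobenius inner product. For positive definite $P$ put $$\phi(P)=\log\left(2^{N(N-1)/4}\,\Gamma_N\!\left(\tfrac{N+1}{2}\right)\right)-\frac{N(N+1)}{2}\log\frac{N+1}{2e}+\frac{N+1}{2}\log\det P,\qquad \Gamma_N(a)=\pi^{N(N-1)/4}\prod_{j=1}^{N}\Gamma\!\left(a-\tfrac{j-1}{2}\right).$$ Here $2^{N(N-1)/4}\Gamma_N(\frac{N+1}{2})=\int_{P\succeq 0}e^{-\operatorname{tr}P}\,dP$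 for the Lebesgue measure $dP$ of the Frobenius inner product on $\mathrm{Sym}(N)$. Let $P^\star\in\mathcal S$ be the positive definite matrix that maximizes $\phi$ over $\mathcal S$ (with $\phi=-\infty$ at singular matrices). Put $Z_k=\sqrt{P^\star}A_k\sqrt{P^\star}$, let $A,B:\mathrm{Sym}(N)\to\mathbb{R}^m$ be the linear maps $AX=(\operatorname{tr}(A_kX))_{k=1}^m$ and $BX=(\operatorname{tr}(Z_kX))_{k=1}^m$, with adjoints $A^\top,B^\top$, and let $$q(t)=\frac1{N+1}\operatorname{tr}\left[\left(\sum_{k=1}^m t_kZ_k\right)^2\right],\qquad t\in\mathbb{R}^m.$$ Suppose that $\lambda>0$, $\theta>0$ and $0<\epsilon\le\frac12$ satisfy $$q(t)\ge\lambda\|t\|_2^2\ \text{ for all } t\in\mathbb{R}^m,\qquad \frac{2}{N+1}\left\|(x^\top Z_kx)_{k=1}^m\right\|_2\le\theta\ \text{ for all } x\in\mathbb{R}^N \text{ with } \|x\|_2=1,$$ $$\lambda\ge\gamma\,\theta^2\epsilon^{-2}\,m\left(m+\log(\epsilon^{-1})\right)^2\log(N\epsilon^{-1}),\qquad \gamma=10^5.$$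 Then the number $$V=\left(\frac{N+1}{4\pi}\right)^{m/2}\left(\frac{\det(AA^\top)}{\det(BB^\top)}\right)^{1/2}e^{\phi(P^\star)}$$ is positive and approximates $\operatorname{vol}(\mathcal S)$ within relative error $\epsilon$, that is, $\left|\dfrac{\operatorname{vol}(\mathcal S)}{V}-1\right|\le\epsilon$. -/

import Mathlib

open MeasureTheory Matrix
open scoped MatrixOrder

namespace SpectrahedronVolume

noncomputable section

/-- The symmetric arrays among the `N × N` arrays of real numbers. -/
def symSubmodule (N : ℕ) : Submodule ℝ (EuclideanSpace ℝ (Fin N × Fin N)) where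
  carrier := {x | ∀ i j, x (i, j) = x (j, i)}
  add_mem' := fun hx hy i j => congrArg₂ (· + ·) (hx i j) (hy i j)
  zero_mem' := fun _ _ => rfl
  smul_mem' := fun c _ hx i j => congrArg (c * ·) (hx i j)

/-- `Sym(N)`: the real symmetric `N × N` matrices, as a real inner product space with the
Frobenius inner product. The matrices are stored by their entries, so that the Euclidean inner
product `∑ᵢⱼ Xᵢⱼ Yᵢⱼ` is `tr (X Y)`; see `inner_eq_trace`. -/
def SymMat (N : ℕ) : Type := symSubmodule N

instance (N : ℕ) : NormedAddCommGroup (SymMat N) :=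
  inferInstanceAs (NormedAddCommGroup (symSubmodule N))

instance (N : ℕ) : InnerProductSpace ℝ (SymMat N) :=
  inferInstanceAs (InnerProductSpace ℝ (symSubmodule N))

instance (N : ℕ) : FiniteDimensional ℝ (SymMat N) :=
  inferInstanceAs (FiniteDimensional ℝ (symSubmodule N))

instance (N : ℕ) : MeasurableSpace (SymMat N) :=
  inferInstanceAs (MeasurableSpace (symSubmodule N))

instance (N : ℕ) : BorelSpace (SymMat N) :=
  inferInstanceAs (BorelSpace (symSubmodule N))

/-- The matrix with the entries of `X`. -/
def SymMat.mat {N : ℕ} (X : SymMat N) : Matrix (Fin N) (Fin N) ℝ :=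
  Matrix.of fun i j => X.1 (i, j)

theorem SymMat.mat_isSymm {N : ℕ} (X : SymMat N) : X.mat.IsSymm := by
  ext i j
  exact X.2 j i

theorem SymMat.mat_add {N : ℕ} (X Y : SymMat N) : (X + Y).mat = X.mat + Y.mat := rfl

theorem SymMat.mat_smul {N : ℕ} (c : ℝ) (X : SymMat N) : (c • X).mat = c • X.mat := rfl

theorem SymMat.inner_eq_trace {N : ℕ} (X Y : SymMat N) :
    inner ℝ X Y = (X.mat * Y.mat).trace := by
  have hY : ∀ i j, Y.1 (i, j) = Y.1 (j, i) := Y.2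
  change inner ℝ X.1 Y.1 = _
  simp only [PiLp.inner_apply, Fintype.sum_prod_type, Matrix.trace,
    Matrix.diag_apply, Matrix.mul_apply, SymMat.mat, Matrix.of_apply]
  refine Finset.sum_congr rfl fun i _ => Finset.sum_congr rfl fun j _ => ?_
  rw [hY i j]
  simp [mul_comm]

/-- The spectrahedron `{P ∈ PSD(N) : tr (A_k P) = b_k for all k}`. -/
def spectrahedron {N m : ℕ} (A : Fin m → SymMat N) (b : Fin m → ℝ) : Set (SymMat N) :=
  {P | P.mat.PosSemidef ∧ ∀ k, ((A k).mat * P.mat).trace = b k}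

/-- The `d`-dimensional volume on `Sym(N)` induced by the Frobenius inner product: on each
`d`-dimensional affine subspace it is the Lebesgue measure of the induced Euclidean structure. -/
def frobeniusVolume {N : ℕ} (d : ℕ) (S : Set (SymMat N)) : ℝ :=
  ((μHE[d] : Measure (SymMat N)) S).toReal

/-- The multivariate gamma function
`Γ_N(a) = π ^ (N (N - 1) / 4) * ∏_{j = 1}^{N} Γ(a - (j - 1) / 2)`. -/
def multivariateGamma (N : ℕ) (a : ℝ) : ℝ :=
  Real.pi ^ ((N : ℝ) * (N - 1) / 4) * ∏ j ∈ Finset.range N, Real.Gamma (a - (j : ℝ) / 2)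

/-- The maximum entropy function `φ` on positive definite matrices: the differential entropy,
relative to the Lebesgue measure of the Frobenius inner product on `Sym(N)`, of the Wishart
distribution with `N + 1` degrees of freedom and expectation `P`.
The Lebesgue measure of the Frobenius inner product is `2 ^ (N (N - 1) / 4) ∏_{i ≤ j} dQᵢⱼ`, so
`2 ^ (N (N - 1) / 4) * Γ_N((N + 1) / 2)` is the integral of `exp (- tr Q)` over `PSD(N)`. -/
def entropy {N : ℕ} (P : SymMat N) : ℝ :=
  Real.log ((2 : ℝ) ^ ((N : ℝ) * (N - 1) / 4) * multivariateGamma N (((N : ℝ) + 1) / 2))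
    - (N : ℝ) * (N + 1) / 2 * Real.log (((N : ℝ) + 1) / (2 * Real.exp 1))
    + ((N : ℝ) + 1) / 2 * Real.log P.mat.det

/-- `P` maximizes `φ` over `S`. As `log det` is `-∞` at the singular positive semidefinite
matrices, the maximizer is a positive definite matrix and competes only with such matrices. -/
structure IsEntropyMaximizer {N : ℕ} (S : Set (SymMat N)) (P : SymMat N) : Prop where
  mem : P ∈ S
  posDef : P.mat.PosDef
  le : ∀ Q ∈ S, Q.mat.PosDef → entropy Q ≤ entropy P

/-- `Z_k = √P A_k √P`, where `√P` is the positive semidefinite square root. -/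
def conjConstraint {N m : ℕ} (A : Fin m → SymMat N) (P : SymMat N) (k : Fin m) :
    Matrix (Fin N) (Fin N) ℝ :=
  CFC.sqrt P.mat * (A k).mat * CFC.sqrt P.mat

/-- The linear operator `Sym(N) → ℝᵐ`, `X ↦ (tr (M_1 X), …, tr (M_m X))`. -/
def traceMap {N m : ℕ} (M : Fin m → Matrix (Fin N) (Fin N) ℝ) :
    SymMat N →ₗ[ℝ] EuclideanSpace ℝ (Fin m) where
  toFun X := WithLp.toLp 2 fun k => (M k * X.mat).trace
  map_add' X Y := by
    ext k
    simp [SymMat.mat_add, Matrix.mul_add]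
  map_smul' c X := by
    ext k
    simp [SymMat.mat_smul]

/-- `det (T Tᵀ)` for a linear operator `T : Sym(N) → ℝᵐ`. -/
def gramDet {N m : ℕ} (T : SymMat N →ₗ[ℝ] EuclideanSpace ℝ (Fin m)) : ℝ :=
  LinearMap.det (T ∘ₗ LinearMap.adjoint T)

/-- The quadratic form `q(t) = tr ((∑ t_k Z_k)²) / (N + 1)`. -/
def quadForm {N m : ℕ} (Z : Fin m → Matrix (Fin N) (Fin N) ℝ) (t : EuclideanSpace ℝ (Fin m)) : ℝ :=
  1 / ((N : ℝ) + 1) * ((∑ k, t k • Z k) ^ 2).trace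

/-- The number `((N+1)/(4π))^(m/2) (det AAᵀ / det BBᵀ)^(1/2) exp (φ(P))`. -/
def volumeApprox {N m : ℕ} (A : Fin m → SymMat N) (P : SymMat N) : ℝ :=
  (((N : ℝ) + 1) / (4 * Real.pi)) ^ ((m : ℝ) / 2)
    * (gramDet (traceMap fun k => (A k).mat) / gramDet (traceMap (conjConstraint A P)))
        ^ ((1 : ℝ) / 2)
    * Real.exp (entropy P)

end

end SpectrahedronVolume

/-!
Write `T X = (tr (A_k X))_k`, `c = (N + 1) / 2`, and let `f X = exp (-c tr (P⁻¹ X))` on the positive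
semidefinite cone and `0` off it: up to a constant, the density of the Wishart distribution with
`N + 1` degrees of freedom and mean `P`. With this number of degrees of freedom the density has no
determinant factor. Maximality of `det P` on the spectrahedron gives `tr (P⁻¹ X) = 0` for `T X = 0`
(`IsEntropyMaximizer.trace_inv_mul_eq_zero`), so `f` is constant, equal to `exp (-c N)`, on the
spectrahedron. Its volume is therefore `exp (c N)` times the integral of `f` over the fibre of `T`
through `P` (`integral_wishartIntegrand_ker`).

That fibre integral is computed by Fourier inversion (`integral_fiber_eq`) as the integral over
`t ∈ ℝᵐ` of the Fourier transform of `f` at `Tᵀ t`, recentred at `P`. Siegel's integral, proved by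
induction on `N` through Schur complements (`integral_diagLaplace`), gives the transform: it is
`∏ⱼ (1 - i μⱼ) ^ (-c)` times the total mass, where `c μⱼ` are the eigenvalues of `∑ t_k Z_k`. The
recentring multiplies it by `exp (-i c ∑ⱼ μⱼ)`, and `q(t) = (c / 2) ∑ⱼ μⱼ²`. Replacing the recentred
transform by `exp (-q(t))` turns the inversion formula into the approximate volume, by a Gaussian
integral (`volumeApprox_eq`).

It remains to bound the error of this replacement. As `|μⱼ| ≤ r := θ ‖t‖`, the third-order Taylor
formula bounds the difference of the exponents by `2 r q`, and concavity of the logarithm bounds the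
modulus of both exponentials by `(1 + r²) ^ (-q / r²)` (`norm_prod_cpow_mul_exp_sub_le`). This
estimate holds for all `t`, so no separate treatment of the tails is needed. Along each ray `q / r²`
is constant and at least `lam / θ²`, and the integral of the bound over the ray is at most `ε` times
that of `exp (-q)` as soon as `16 m³ ≤ ε² lam / θ²` (`lintegral_ray_error_le`); polar coordinates
give the same comparison on `ℝᵐ`.

Fourier inversion at a point needs continuity of the fibre integral there
(`continuousAt_integral_wishartIntegrand`) and integrability of the transform. The latter follows
from the error estimate, the former from compactness of the spectrahedron and the fact that a convex
set has a null boundary.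
-/

namespace SpectrahedronVolume

/-! ### The logarithm near the imaginary direction and the pointwise Gaussian approximation -/

theorem norm_exp_sub_exp_le {a b : ℂ} {B : ℝ} (ha : a.re ≤ B) (hb : b.re ≤ B) :
    ‖Complex.exp a - Complex.exp b‖ ≤ Real.exp B * ‖a - b‖ := by
  refine (convex_halfSpace_re_le B).norm_image_sub_le_of_norm_hasDerivWithin_le
    (f := Complex.exp) (f' := Complex.exp)
    (fun x _ => (Complex.hasDerivAt_exp x).hasDerivWithinAt) (fun x hx => ?_) hb ha
  rw [Complex.norm_exp]
  exact Real.exp_le_exp.mpr hx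

theorem one_sub_mul_I_mem_slitPlane (x : ℝ) : 1 - x * Complex.I ∈ Complex.slitPlane :=
  Complex.mem_slitPlane_iff.mpr (Or.inl (by simp))

theorem norm_one_sub_mul_I (x : ℝ) : ‖1 - x * Complex.I‖ = (1 + x ^ 2) ^ (1 / 2 : ℝ) := by
  rw [← Real.sqrt_eq_rpow, Complex.norm_def, Complex.normSq_apply]
  congr 1
  simp
  ring

theorem re_log_one_sub_mul_I (x : ℝ) :
    (Complex.log (1 - x * Complex.I)).re = Real.log (1 + x ^ 2) / 2 := by
  rw [Complex.log_re, norm_one_sub_mul_I, Real.log_rpow (by positivity)]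
  ring

/-- The third order Taylor bound for `log (1 - i x)`; it holds for all real `x`. -/
theorem norm_log_one_sub_mul_I_sub_le (x : ℝ) :
    ‖-Complex.log (1 - x * Complex.I) - x * Complex.I + (x : ℂ) ^ 2 / 2‖ ≤ |x| ^ 3 := by
  let f : ℝ → ℂ := fun s => -Complex.log (1 - s * Complex.I) - s * Complex.I + (s : ℂ) ^ 2 / 2
  let f' : ℝ → ℂ := fun s => -(-Complex.I / (1 - s * Complex.I)) - Complex.I + s
  have hd : ∀ s : ℝ, HasDerivAt f (f' s) s := by
    intro s
    have h0 : HasDerivAt (fun s : ℝ => (s : ℂ)) 1 s := Complex.ofRealCLM.hasDerivAt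
    have h1 : HasDerivAt (fun s : ℝ => (1 : ℂ) - s * Complex.I) (-Complex.I) s := by
      simpa using (h0.mul_const Complex.I).const_sub 1
    have h2 := (h1.clog_real (one_sub_mul_I_mem_slitPlane s)).neg
    have h3 := (h2.sub (h0.mul_const Complex.I)).add ((h0.pow 2).div_const 2)
    refine h3.congr_deriv ?_
    have h4 : ((2 : ℕ) : ℂ) * (s : ℂ) ^ (2 - 1) * 1 / 2 = s := by
      norm_num
    change -(-Complex.I / (1 - s * Complex.I)) - 1 * Complex.I + _ = _
    linear_combination h4
  have hn : ∀ s : ℝ, |s| ≤ |x| → ‖f' s‖ ≤ |x| ^ 2 := by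
    intro s hs
    have hne := Complex.slitPlane_ne_zero (one_sub_mul_I_mem_slitPlane s)
    have : f' s = -(Complex.I * s ^ 2) / (1 - s * Complex.I) := by
      have h2 := div_mul_cancel₀ Complex.I hne
      rw [eq_div_iff hne]
      simp only [f', neg_div, neg_neg]
      linear_combination h2 + s * Complex.I_sq
    rw [this, norm_div, norm_neg, norm_mul, Complex.norm_I, one_mul, norm_pow, Complex.norm_real,
      Real.norm_eq_abs, div_le_iff₀ (norm_pos_iff.mpr hne)]
    have h1 : (1 : ℝ) ≤ ‖1 - s * Complex.I‖ := by
      rw [norm_one_sub_mul_I]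
      exact Real.one_le_rpow (by nlinarith [sq_nonneg s]) (by norm_num)
    calc |s| ^ 2 ≤ |x| ^ 2 * 1 := by rw [mul_one]; gcongr
      _ ≤ _ := by gcongr
  have := (convex_Icc (-|x|) |x|).norm_image_sub_le_of_norm_hasDerivWithin_le
    (f := f) (f' := f') (fun s _ => (hd s).hasDerivWithinAt)
    (fun s hs => hn s (abs_le.mpr hs)) (x := 0) (y := x)
    ⟨neg_nonpos.mpr (abs_nonneg x), abs_nonneg x⟩ (abs_le.mp le_rfl)
  have h0 : f 0 = 0 := by simp [f]
  rw [h0, sub_zero, sub_zero, Real.norm_eq_abs] at this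
  calc _ = ‖f x‖ := rfl
    _ ≤ _ := this
    _ = _ := by ring

/-- Concavity of the logarithm: `log (1 + ·)` lies above its chord on `[0, r ^ 2]`. -/
theorem mul_log_one_add_sq_le {x r : ℝ} (hr : 0 < r) (hx : |x| ≤ r) :
    x ^ 2 / r ^ 2 * Real.log (1 + r ^ 2) ≤ Real.log (1 + x ^ 2) := by
  have hx2 : x ^ 2 ≤ r ^ 2 := sq_le_sq' (abs_le.mp hx).1 (abs_le.mp hx).2
  have h := rpow_one_add_le_one_add_mul_self (s := r ^ 2) (p := x ^ 2 / r ^ 2)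
    (by nlinarith [sq_nonneg r]) (by positivity) ((div_le_one (by positivity)).mpr hx2)
  rw [div_mul_cancel₀ _ (by positivity)] at h
  rw [← Real.log_rpow (by positivity)]
  exact Real.log_le_log (by positivity) h

/-- The characteristic function of a centred combination of chi-square variables is close to that
of the Gaussian with the same variance. The bound is useful for all arguments: its last factor
is integrable in the tails. -/
theorem norm_prod_cpow_mul_exp_sub_le {ι : Type*} [Fintype ι] {μ : ι → ℝ} {c r : ℝ}
    (hc : 0 < c) (hr : 0 < r) (hμ : ∀ j, |μ j| ≤ r) :
    ‖(∏ j, (1 - μ j * Complex.I) ^ (-c : ℂ)) * Complex.exp (-(c * ∑ j, μ j : ℝ) * Complex.I)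
        - Complex.exp (-(c / 2 * ∑ j, μ j ^ 2 : ℝ))‖
      ≤ 2 * r * (c / 2 * ∑ j, μ j ^ 2) *
        (1 + r ^ 2) ^ (-((c / 2 * ∑ j, μ j ^ 2) / r ^ 2)) := by
  set q := c / 2 * ∑ j, μ j ^ 2 with hq
  have hq0 : 0 ≤ q := by positivity
  -- The sum of the Taylor remainders `z j` is the difference of the two exponents, up to `c`.
  let z : ι → ℂ := fun j => -Complex.log (1 - μ j * Complex.I) - μ j * Complex.I + (μ j : ℂ) ^ 2 / 2
  have hprod : (∏ j, (1 - μ j * Complex.I) ^ (-c : ℂ)) *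
      Complex.exp (-(c * ∑ j, μ j : ℝ) * Complex.I) = Complex.exp (-(q : ℂ) + c * ∑ j, z j) := by
    have h1 : ∀ j, (1 - μ j * Complex.I) ^ (-c : ℂ)
        = Complex.exp (Complex.log (1 - μ j * Complex.I) * (-c)) := fun j =>
      Complex.cpow_def_of_ne_zero
        (Complex.slitPlane_ne_zero (one_sub_mul_I_mem_slitPlane (μ j))) _
    simp only [h1]
    rw [← Complex.exp_sum, ← Complex.exp_add, hq]
    congr 1
    push_cast
    simp only [z, Finset.mul_sum, Finset.sum_mul, ← Finset.sum_neg_distrib,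
      ← Finset.sum_add_distrib]
    refine Finset.sum_congr rfl fun j _ => ?_
    ring
  have hlog : Real.log (1 + r ^ 2) ≤ r ^ 2 := by
    have := Real.log_le_sub_one_of_pos (show 0 < 1 + r ^ 2 by positivity)
    linarith
  have hre : (-(q : ℂ) + c * ∑ j, z j).re ≤ -(q / r ^ 2) * Real.log (1 + r ^ 2) := by
    have h1 : (-(q : ℂ) + c * ∑ j, z j).re = -(c / 2 * ∑ j, Real.log (1 + μ j ^ 2)) := by
      have h2 : ∀ j, (z j).re = -(Real.log (1 + μ j ^ 2) / 2) + μ j ^ 2 / 2 := by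
        intro j
        simp only [z, Complex.add_re, Complex.sub_re, Complex.neg_re, re_log_one_sub_mul_I]
        have : ((μ j : ℂ) ^ 2 / 2).re = μ j ^ 2 / 2 := by
          rw [show ((μ j : ℂ) ^ 2 / 2) = ((μ j ^ 2 / 2 : ℝ) : ℂ) by push_cast; rfl,
            Complex.ofReal_re]
        simp [this]
      rw [Complex.add_re, Complex.re_ofReal_mul, Complex.re_sum, Complex.neg_re, Complex.ofReal_re,
        Finset.sum_congr rfl fun j _ => h2 j, hq]
      simp only [Finset.mul_sum, ← Finset.sum_neg_distrib, ← Finset.sum_add_distrib]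
      refine Finset.sum_congr rfl fun j _ => ?_
      ring
    rw [h1, neg_mul]
    refine neg_le_neg ?_
    rw [hq, mul_div_assoc, mul_assoc, Finset.sum_div, Finset.sum_mul]
    gcongr with j
    exact mul_log_one_add_sq_le hr (hμ j)
  have hre' : (-(q : ℝ) : ℂ).re ≤ -(q / r ^ 2) * Real.log (1 + r ^ 2) := by
    rw [Complex.neg_re, Complex.ofReal_re, neg_mul]
    refine neg_le_neg ?_
    calc _ ≤ q / r ^ 2 * r ^ 2 := by gcongr
      _ = q := by field_simp
  have hR : ‖(c : ℂ) * ∑ j, z j‖ ≤ 2 * r * q := by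
    rw [norm_mul, Complex.norm_real, Real.norm_of_nonneg hc.le]
    calc c * ‖∑ j, z j‖ ≤ c * ∑ j, r * μ j ^ 2 := by
          gcongr
          refine norm_sum_le_of_le _ fun j _ => (norm_log_one_sub_mul_I_sub_le (μ j)).trans ?_
          rw [pow_succ' |μ j| 2, sq_abs]
          gcongr
          exact hμ j
      _ = 2 * r * q := by rw [hq, ← Finset.mul_sum]; ring
  rw [hprod]
  refine (norm_exp_sub_exp_le hre hre').trans ?_
  rw [add_sub_cancel_left, Real.rpow_def_of_pos (by positivity), mul_comm (2 * r * q)]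
  rw [mul_comm (Real.log _)]
  gcongr

/-! ### Comparison of integrals along rays -/

/-- Integration in polar coordinates. -/
theorem lintegral_eq_lintegral_sphere_mul {E : Type*} [NormedAddCommGroup E] [NormedSpace ℝ E]
    [FiniteDimensional ℝ E] [MeasurableSpace E] [BorelSpace E] [Nontrivial E]
    (μ : Measure E) [μ.IsAddHaarMeasure] {F : E → ENNReal} (hF : Measurable F) :
    ∫⁻ x, F x ∂μ = ∫⁻ u : Metric.sphere (0 : E) 1, (∫⁻ s in Set.Ioi (0 : ℝ),
      ENNReal.ofReal (s ^ (Module.finrank ℝ E - 1)) * F (s • (u : E))) ∂μ.toSphere := by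
  have h1 : ∫⁻ x, F x ∂μ = ∫⁻ x : ({(0)}ᶜ : Set E), F x ∂(μ.comap (↑)) := by
    rw [lintegral_subtype_comap (measurableSet_singleton _).compl, restrict_compl_singleton]
  have h2 := (μ.measurePreserving_homeomorphUnitSphereProd).symm
    (homeomorphUnitSphereProd E).toMeasurableEquiv
  have h3 : Measurable fun p : Metric.sphere (0 : E) 1 × Set.Ioi (0 : ℝ) =>
      F ((p.2 : ℝ) • (p.1 : E)) := by fun_prop
  rw [h1]
  refine (h2.lintegral_comp (hF.comp measurable_subtype_coe)).symm.trans ?_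
  have h4 : ∀ p : Metric.sphere (0 : E) 1 × Set.Ioi (0 : ℝ),
      (((homeomorphUnitSphereProd E).toMeasurableEquiv.symm p : ({0}ᶜ : Set E)) : E)
        = (p.2 : ℝ) • (p.1 : E) := fun p => rfl
  simp only [Function.comp_apply, h4]
  rw [lintegral_prod _ h3.aemeasurable]
  refine lintegral_congr fun u => ?_
  rw [Measure.volumeIoiPow, lintegral_withDensity_eq_lintegral_mul _ (by fun_prop) (by fun_prop)]
  rw [← lintegral_subtype_comap measurableSet_Ioi]
  rfl

/-- To compare two integrals it suffices to compare them along every ray. -/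
theorem lintegral_le_mul_lintegral_of_rays {E : Type*} [NormedAddCommGroup E] [NormedSpace ℝ E]
    [FiniteDimensional ℝ E] [MeasurableSpace E] [BorelSpace E] [Nontrivial E]
    (μ : Measure E) [μ.IsAddHaarMeasure] {F G : E → ENNReal} (hF : Measurable F)
    (hG : Measurable G) (c : ENNReal)
    (h : ∀ u : E, ‖u‖ = 1 →
      ∫⁻ s in Set.Ioi (0 : ℝ), ENNReal.ofReal (s ^ (Module.finrank ℝ E - 1)) * F (s • u)
        ≤ c * ∫⁻ s in Set.Ioi (0 : ℝ),
          ENNReal.ofReal (s ^ (Module.finrank ℝ E - 1)) * G (s • u)) :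
    ∫⁻ x, F x ∂μ ≤ c * ∫⁻ x, G x ∂μ := by
  rw [lintegral_eq_lintegral_sphere_mul μ hF, lintegral_eq_lintegral_sphere_mul μ hG,
    ← lintegral_const_mul]
  · exact lintegral_mono fun u => h u (by simp)
  · refine Measurable.lintegral_prod_right' (f := fun p : Metric.sphere (0 : E) 1 × ℝ =>
      ENNReal.ofReal (p.2 ^ (Module.finrank ℝ E - 1)) * G (p.2 • (p.1 : E))) ?_
    fun_prop

/-- A case of the log-convexity of the Gamma function. -/
theorem Gamma_add_half_le {x : ℝ} (hx : 0 < x) :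
    Real.Gamma (x + 1 / 2) ≤ √x * Real.Gamma x := by
  have h := Real.Gamma_mul_add_mul_le_rpow_Gamma_mul_rpow_Gamma (s := x) (t := x + 1)
    (a := 1 / 2) (b := 1 / 2) hx (by linarith) (by norm_num) (by norm_num) (by norm_num)
  have hG := Real.Gamma_pos_of_pos hx
  rw [Real.Gamma_add_one hx.ne', ← Real.sqrt_eq_rpow, ← Real.sqrt_eq_rpow,
    Real.sqrt_mul hx.le, show 1 / 2 * x + 1 / 2 * (x + 1) = x + 1 / 2 by ring] at h
  refine h.trans (le_of_eq ?_)
  linear_combination √x * Real.mul_self_sqrt hG.le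

theorem lintegral_pow_mul_exp_neg_mul_sq {m : ℕ} (hm : 1 ≤ m) {k : ℝ} (hk : 0 < k) :
    ∫⁻ s in Set.Ioi (0 : ℝ), ENNReal.ofReal (s ^ (m - 1) * Real.exp (-(k * s ^ 2))) =
      ENNReal.ofReal (Real.Gamma (m / 2) / 2 * k ^ (-(m / 2 : ℝ))) := by
  have hm' : (1 : ℝ) ≤ m := by exact_mod_cast hm
  have h1 := integrableOn_rpow_mul_exp_neg_mul_rpow (p := 2) (s := m - 1) (b := k)
    (by linarith) (by norm_num) hk
  have h2 := integral_rpow_mul_exp_neg_mul_rpow (p := 2) (q := m - 1) (b := k)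
    (by norm_num) (by linarith) hk
  have h3 : ∀ s ∈ Set.Ioi (0 : ℝ), s ^ ((m : ℝ) - 1) * Real.exp (-k * s ^ (2 : ℝ))
      = s ^ (m - 1) * Real.exp (-(k * s ^ 2)) := by
    intro s hs
    rw [← Real.rpow_natCast s (m - 1), Nat.cast_sub hm, ← Real.rpow_natCast s 2]
    simp
  rw [setIntegral_congr_fun measurableSet_Ioi h3] at h2
  rw [integrableOn_congr_fun h3 measurableSet_Ioi] at h1
  rw [← ofReal_integral_eq_lintegral_ofReal h1, h2]
  · congr 1
    rw [sub_add_cancel, neg_div]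
    ring
  · filter_upwards [ae_restrict_mem measurableSet_Ioi] with s hs
    have : 0 < s := hs
    positivity

/-- The substitution `x = log (1 + (θ s) ^ 2)` and `exp x - 1 ≤ x exp x` bound the tail integrand
by a Gamma integral. -/
theorem lintegral_pow_mul_one_add_sq_rpow_le (m : ℕ) {θ K : ℝ} (hθ : 0 < θ)
    (hK : ((m : ℝ) + 3) / 2 < K) :
    ∫⁻ s in Set.Ioi (0 : ℝ), ENNReal.ofReal (s ^ (m + 2) * (1 + (θ * s) ^ 2) ^ (-K)) ≤
      ENNReal.ofReal ((θ ^ (m + 3))⁻¹ / 2 *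
        ((1 / (K - (m + 3) / 2)) ^ (((m : ℝ) + 3) / 2) * Real.Gamma ((m + 3) / 2))) := by
  -- `f` is the inverse of `s ↦ log (1 + (θ s) ^ 2)`.
  let f : ℝ → ℝ := fun x => √(Real.exp x - 1) / θ
  have hpos : ∀ x ∈ Set.Ioi (0 : ℝ), 0 < Real.exp x - 1 := fun x hx => by
    have := Real.add_one_lt_exp (ne_of_gt hx)
    have hx' : 0 < x := hx
    linarith
  have himage : f '' Set.Ioi 0 = Set.Ioi 0 := by
    ext y
    constructor
    · rintro ⟨x, hx, rfl⟩
      exact div_pos (Real.sqrt_pos.mpr (hpos x hx)) hθ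
    · intro hy
      have hy' : 0 < y := hy
      refine ⟨Real.log (1 + (θ * y) ^ 2), Real.log_pos (by nlinarith [mul_pos hθ hy']), ?_⟩
      simp only [f]
      rw [Real.exp_log (by positivity), add_sub_cancel_left, Real.sqrt_sq (by positivity)]
      field_simp
  have hderiv : ∀ x ∈ Set.Ioi (0 : ℝ),
      HasDerivWithinAt f (Real.exp x / (2 * √(Real.exp x - 1)) / θ) (Set.Ioi 0) x := by
    intro x hx
    exact ((((Real.hasDerivAt_exp x).sub_const 1).sqrt (hpos x hx).ne').div_const
      θ).hasDerivWithinAt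
  have hinj : Set.InjOn f (Set.Ioi 0) := by
    intro x hx y hy hxy
    have h1 : √(Real.exp x - 1) = √(Real.exp y - 1) := by
      have := congrArg (· * θ) hxy
      simpa [f, hθ.ne'] using this
    have h2 := (Real.sqrt_inj (hpos x hx).le (hpos y hy).le).mp h1
    exact Real.exp_injective (by linarith)
  conv_lhs => rw [← himage]
  rw [lintegral_image_eq_lintegral_abs_deriv_mul measurableSet_Ioi hderiv hinj]
  have ha : 0 < ((m : ℝ) + 3) / 2 := by positivity
  have hg := Real.integral_rpow_mul_exp_neg_mul_Ioi ha (sub_pos.mpr hK)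
  have hint : IntegrableOn (fun x : ℝ => x ^ (((m : ℝ) + 3) / 2 - 1) *
      Real.exp (-((K - (m + 3) / 2) * x))) (Set.Ioi 0) := by
    have := integrableOn_rpow_mul_exp_neg_mul_rpow (p := 1) (s := ((m : ℝ) + 3) / 2 - 1)
      (b := K - (m + 3) / 2) (by linarith) one_pos (sub_pos.mpr hK)
    simpa only [Real.rpow_one, neg_mul] using this
  rw [← hg, ← integral_const_mul, ofReal_integral_eq_lintegral_ofReal (hint.const_mul _)]
  · refine setLIntegral_mono' measurableSet_Ioi fun x hx => ?_
    have hx' : 0 < x := hx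
    have hp := hpos x hx
    rw [← ENNReal.ofReal_mul (abs_nonneg _)]
    refine ENNReal.ofReal_le_ofReal ?_
    rw [abs_of_nonneg (by positivity)]
    set y := √(Real.exp x - 1) with hy
    have hy0 : 0 < y := Real.sqrt_pos.mpr hp
    have hy2 : y ^ 2 = Real.exp x - 1 := Real.sq_sqrt hp.le
    have h1 : 1 + (θ * f x) ^ 2 = Real.exp x := by
      have : θ * f x = y := by
        simp only [f]
        field_simp
        exact hy.symm
      rw [this, hy2]
      ring
    have h2 : y ^ (m + 1) ≤ x ^ (((m : ℝ) + 3) / 2 - 1) * Real.exp (x * ((m + 1) / 2)) := by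
      have h3 : y ^ (m + 1) = (Real.exp x - 1) ^ (((m : ℝ) + 1) / 2) := by
        rw [hy, Real.sqrt_eq_rpow, ← Real.rpow_natCast, ← Real.rpow_mul hp.le]
        congr 1
        push_cast
        ring
      have h4 : Real.exp x - 1 ≤ x * Real.exp x := by
        have := Real.add_one_le_exp (-x)
        have h5 : Real.exp (-x) * Real.exp x = 1 := by rw [← Real.exp_add]; simp
        nlinarith [Real.exp_pos x]
      rw [h3, Real.exp_mul, show ((m : ℝ) + 3) / 2 - 1 = ((m : ℝ) + 1) / 2 by ring,
        ← Real.mul_rpow hx'.le (Real.exp_pos x).le]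
      exact Real.rpow_le_rpow hp.le h4 (by positivity)
    rw [h1, ← Real.exp_mul]
    calc Real.exp x / (2 * y) / θ * ((y / θ) ^ (m + 2) * Real.exp (x * -K))
        = (θ ^ (m + 3))⁻¹ / 2 * (y ^ (m + 1) * (Real.exp x * Real.exp (x * -K))) := by
          simp only [div_pow, pow_add]
          field_simp
      _ ≤ (θ ^ (m + 3))⁻¹ / 2 * (x ^ (((m : ℝ) + 3) / 2 - 1) *
            Real.exp (x * ((m + 1) / 2)) * (Real.exp x * Real.exp (x * -K))) := by gcongr
      _ = _ := by
          rw [mul_assoc (x ^ _), ← Real.exp_add, ← Real.exp_add]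
          congr 3
          ring
  · filter_upwards [ae_restrict_mem measurableSet_Ioi] with s hs
    have : 0 < s := hs
    positivity

/-- Comparison of the error bound with the Gaussian on a ray on which the quadratic form is
`k s ^ 2`. -/
theorem lintegral_ray_error_le {m : ℕ} (hm : 1 ≤ m) {k θ ε : ℝ} (hθ : 0 < θ) (hε : 0 < ε)
    (hε' : ε ≤ 1 / 2) (hk : 16 * (m : ℝ) ^ 3 ≤ ε ^ 2 * (k / θ ^ 2)) :
    ∫⁻ s in Set.Ioi (0 : ℝ), ENNReal.ofReal (s ^ (m - 1)) * ENNReal.ofReal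
        (2 * (θ * s) * (k * s ^ 2) * (1 + (θ * s) ^ 2) ^ (-(k * s ^ 2 / (θ * s) ^ 2)))
      ≤ ENNReal.ofReal ε * ∫⁻ s in Set.Ioi (0 : ℝ), ENNReal.ofReal (s ^ (m - 1)) *
        ENNReal.ofReal (Real.exp (-(k * s ^ 2))) := by
  have hm' : (1 : ℝ) ≤ m := by exact_mod_cast hm
  set K := k / θ ^ 2 with hKdef
  set a : ℝ := ((m : ℝ) + 3) / 2 with ha
  have hε2 : ε ^ 2 ≤ 1 / 4 := by nlinarith
  have hK64 : 64 * (m : ℝ) ^ 3 ≤ K := by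
    have h0 : 0 ≤ K := by
      by_contra hneg
      push Not at hneg
      have : ε ^ 2 * K < 0 := mul_neg_of_pos_of_neg (by positivity) hneg
      have : (0 : ℝ) ≤ 16 * (m : ℝ) ^ 3 := by positivity
      linarith
    nlinarith
  have hm3 : (m : ℝ) ^ 2 ≤ (m : ℝ) ^ 3 := pow_le_pow_right₀ hm' (by norm_num)
  have hm2 : (m : ℝ) ≤ (m : ℝ) ^ 2 := by nlinarith
  have hKpos : 0 < K := by nlinarith
  have hkK : k = K * θ ^ 2 := by rw [hKdef]; field_simp
  have hkpos : 0 < k := by rw [hkK]; positivity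
  have ha2 : a ≤ 2 * m := by rw [ha]; linarith
  have ha1 : 2 ≤ a := by rw [ha]; linarith
  have haK : a < K := by nlinarith
  have haa : 2 * (a * a) ≤ K := by nlinarith
  -- Both sides reduce to Gamma values.
  have hR : ∫⁻ s in Set.Ioi (0 : ℝ), ENNReal.ofReal (s ^ (m - 1)) *
        ENNReal.ofReal (Real.exp (-(k * s ^ 2)))
      = ENNReal.ofReal (Real.Gamma (m / 2) / 2 * k ^ (-(m / 2 : ℝ))) := by
    rw [← lintegral_pow_mul_exp_neg_mul_sq hm hkpos]
    refine setLIntegral_congr_fun measurableSet_Ioi fun s hs => ?_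
    have : 0 < s := hs
    exact (ENNReal.ofReal_mul (by positivity)).symm
  have hL : ∫⁻ s in Set.Ioi (0 : ℝ), ENNReal.ofReal (s ^ (m - 1)) * ENNReal.ofReal
        (2 * (θ * s) * (k * s ^ 2) * (1 + (θ * s) ^ 2) ^ (-(k * s ^ 2 / (θ * s) ^ 2)))
      = ENNReal.ofReal (2 * θ * k) * ∫⁻ s in Set.Ioi (0 : ℝ),
          ENNReal.ofReal (s ^ (m + 2) * (1 + (θ * s) ^ 2) ^ (-K)) := by
    rw [← lintegral_const_mul _ (by fun_prop)]
    refine setLIntegral_congr_fun measurableSet_Ioi fun s hs => ?_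
    have hs' : 0 < s := hs
    rw [← ENNReal.ofReal_mul (by positivity), ← ENNReal.ofReal_mul (by positivity)]
    congr 1
    have h1 : k * s ^ 2 / (θ * s) ^ 2 = K := by rw [hKdef]; field_simp
    have h2 : s ^ (m + 2) = s ^ (m - 1) * s ^ 3 := by
      rw [← pow_add]
      congr 1
      omega
    rw [h1, h2]
    ring
  rw [hR, hL]
  refine (mul_le_mul_right (lintegral_pow_mul_one_add_sq_rpow_le m hθ haK) _).trans ?_
  rw [← ENNReal.ofReal_mul (by positivity), ← ENNReal.ofReal_mul (by positivity)]
  refine ENNReal.ofReal_le_ofReal ?_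
  rw [← ha]
  have hG := Real.Gamma_pos_of_pos (show (0 : ℝ) < m / 2 by positivity)
  have hGa : Real.Gamma a ≤ m * √m * Real.Gamma (m / 2) := by
    have h1 : a = ((m : ℝ) / 2 + 1 / 2) + 1 := by rw [ha]; ring
    rw [h1, Real.Gamma_add_one (by positivity)]
    have h2 := Gamma_add_half_le (show (0 : ℝ) < m / 2 by positivity)
    have h3 : √((m : ℝ) / 2) ≤ √m := Real.sqrt_le_sqrt (by linarith)
    calc _ ≤ (m : ℝ) * (√m * Real.Gamma (m / 2)) := by
          refine mul_le_mul (by linarith) (h2.trans ?_) (by positivity) (by positivity)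
          gcongr
      _ = _ := by ring
  -- Bernoulli's inequality; `2 * a ^ 2 ≤ K` makes the loss at most a factor `2`.
  have hpow : (1 / (K - a)) ^ a ≤ 2 * K ^ (-a) := by
    have h1 : K - a = K * (1 + -(a / K)) := by field_simp; ring
    have h2 : a / K ≤ 1 := (div_le_one hKpos).mpr haK.le
    have h3 := one_add_mul_self_le_rpow_one_add (s := -(a / K)) (by linarith)
      (show 1 ≤ a by linarith)
    have h4 : 1 / 2 ≤ (1 + -(a / K)) ^ a := by
      refine le_trans ?_ h3
      have : a * (a / K) ≤ 1 / 2 := by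
        rw [← mul_div_assoc, div_le_iff₀ hKpos]
        linarith
      linarith
    have h5 : 0 ≤ 1 + -(a / K) := by linarith
    rw [one_div, Real.inv_rpow (by linarith), h1, Real.mul_rpow hKpos.le h5, mul_inv,
      Real.rpow_neg hKpos.le, mul_comm]
    gcongr
    exact inv_le_of_inv_le₀ (by norm_num) (by simpa using h4)
  have hsqrt : 4 * (m * √m) ≤ ε * √K := by
    have h1 : 0 ≤ ε * √K := by positivity
    refine le_of_sq_le_sq ?_ h1
    have h2 := Real.sq_sqrt hKpos.le
    have h3 := Real.sq_sqrt (show (0 : ℝ) ≤ m by positivity)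
    calc (4 * (m * √m)) ^ 2 = 16 * (m : ℝ) ^ 2 * √m ^ 2 := by ring
      _ = 16 * (m : ℝ) ^ 3 := by rw [h3]; ring
      _ ≤ ε ^ 2 * K := hk
      _ = _ := by rw [mul_pow, h2]
  have hkpow : k ^ (-((m : ℝ) / 2)) = K ^ (-((m : ℝ) / 2)) * (θ ^ m)⁻¹ := by
    rw [hkK, Real.mul_rpow hKpos.le (by positivity), Real.rpow_neg (x := θ ^ 2) (by positivity),
      ← Real.rpow_natCast θ 2, ← Real.rpow_mul hθ.le]
    congr 2
    rw [← Real.rpow_natCast]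
    congr 1
    push_cast
    ring
  have hKpow : K * K ^ (-a) * √K = K ^ (-((m : ℝ) / 2)) := by
    rw [Real.sqrt_eq_rpow, ← Real.rpow_one_add' hKpos.le, ← Real.rpow_add hKpos]
    · congr 1
      rw [ha]
      ring
    · linarith
  rw [hkpow, ← hKpow]
  calc 2 * θ * k * ((θ ^ (m + 3))⁻¹ / 2 * ((1 / (K - a)) ^ a * Real.Gamma a))
      = (θ ^ m)⁻¹ * K * ((1 / (K - a)) ^ a * Real.Gamma a) := by
        rw [hkK, pow_add]
        field_simp
    _ ≤ (θ ^ m)⁻¹ * K * ((2 * K ^ (-a)) * (m * √m * Real.Gamma (m / 2))) := by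
        gcongr
    _ = (θ ^ m)⁻¹ * K * K ^ (-a) * Real.Gamma (m / 2) / 2 * (4 * (m * √m)) := by ring
    _ ≤ (θ ^ m)⁻¹ * K * K ^ (-a) * Real.Gamma (m / 2) / 2 * (ε * √K) := by gcongr
    _ = _ := by ring

/-! ### Gamma and Gauss integrals with complex parameters -/

theorem ofReal_mul_cpow {r : ℝ} (hr : 0 < r) {z : ℂ} (hz : z ≠ 0) (s : ℂ) :
    ((r : ℂ) * z) ^ s = (r : ℂ) ^ s * z ^ s := by
  have hr' : (r : ℂ) ≠ 0 := Complex.ofReal_ne_zero.mpr hr.ne'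
  rw [Complex.cpow_def_of_ne_zero (mul_ne_zero hr' hz), Complex.cpow_def_of_ne_zero hr',
    Complex.cpow_def_of_ne_zero hz, Complex.log_ofReal_mul hr hz, Complex.ofReal_log hr.le,
    add_mul, Complex.exp_add]

theorem ne_zero_of_re_pos {z : ℂ} (hz : 0 < z.re) : z ≠ 0 := by
  rintro rfl
  simp at hz

theorem ofReal_div_cpow {r : ℝ} (hr : 0 < r) {z : ℂ} (hz : 0 < z.re) (s : ℂ) :
    ((r : ℂ) / z) ^ s = (r : ℂ) ^ s * z ^ (-s) := by
  have harg : z.arg ≠ Real.pi :=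
    Complex.slitPlane_arg_ne_pi (Complex.mem_slitPlane_iff.mpr (Or.inl hz))
  rw [div_eq_mul_inv, ofReal_mul_cpow hr (inv_ne_zero (ne_zero_of_re_pos hz)),
    Complex.inv_cpow _ _ harg, Complex.cpow_neg]

/-- The Gamma integral with a complex rate, for half-integral exponents: it is the radial part
of a complex Gaussian integral on `ℝ ^ k`. -/
theorem integral_rpow_mul_cexp_neg_mul {k : ℕ} (hk : 1 ≤ k) {a : ℂ} (ha : 0 < a.re) :
    ∫ x in Set.Ioi (0 : ℝ), ((x ^ ((k : ℝ) / 2 - 1) : ℝ) : ℂ) * Complex.exp (-(a * x)) =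
      (Real.Gamma (k / 2) : ℂ) * a ^ (-(k / 2 : ℂ)) := by
  have : Nonempty (Fin k) := ⟨⟨0, hk⟩⟩
  let E := EuclideanSpace ℝ (Fin k)
  -- The Gaussian integral on `ℝ ^ k` in polar coordinates, after substituting `x = s ^ 2`; the
  -- constant `C` is the area of the unit sphere up to a factor, found below by taking `b = 1`.
  obtain ⟨C, hC⟩ : ∃ C : ℂ, ∀ b : ℂ, 0 < b.re →
      C * ∫ x in Set.Ioi (0 : ℝ), ((x ^ ((k : ℝ) / 2 - 1) : ℝ) : ℂ) * Complex.exp (-(b * x)) =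
        (Real.pi : ℂ) ^ (k / 2 : ℂ) * b ^ (-(k / 2 : ℂ)) := by
    refine ⟨k * (volume.real (Metric.ball (0 : E) 1) : ℂ) * 2⁻¹, fun b hb => ?_⟩
    rw [← ofReal_div_cpow Real.pi_pos hb]
    have h1 := GaussianFourier.integral_cexp_neg_mul_sq_norm (V := E) hb
    have h2 := integral_fun_norm_addHaar (volume : Measure E)
      (fun y : ℝ => Complex.exp (-b * y ^ 2))
    have h3 := integral_comp_rpow_Ioi
      (fun y : ℝ => y ^ (k - 1) • Complex.exp (-b * (y : ℂ) ^ 2)) (p := 1 / 2) (by norm_num)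
    have h4 : ∫ x in Set.Ioi (0 : ℝ), (|(1 / 2 : ℝ)| * x ^ ((1 / 2 : ℝ) - 1)) •
          ((x ^ (1 / 2 : ℝ)) ^ (k - 1) • Complex.exp (-b * ((x ^ (1 / 2 : ℝ) : ℝ) : ℂ) ^ 2))
        = 2⁻¹ * ∫ x in Set.Ioi (0 : ℝ),
          ((x ^ ((k : ℝ) / 2 - 1) : ℝ) : ℂ) * Complex.exp (-(b * x)) := by
      rw [← integral_const_mul]
      refine setIntegral_congr_fun measurableSet_Ioi fun x hx => ?_
      have hx' : 0 < x := hx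
      have h5 : (x ^ (1 / 2 : ℝ)) ^ 2 = x := by
        rw [← Real.sqrt_eq_rpow, Real.sq_sqrt hx'.le]
      have h6 : x ^ ((1 / 2 : ℝ) - 1) * (x ^ (1 / 2 : ℝ)) ^ (k - 1) = x ^ ((k : ℝ) / 2 - 1) := by
        rw [← Real.rpow_natCast, ← Real.rpow_mul hx'.le, ← Real.rpow_add hx']
        congr 1
        rw [Nat.cast_sub hk]
        push_cast
        ring
      rw [← Complex.ofReal_pow, h5, ← h6, smul_smul, Complex.real_smul,
        abs_of_pos (by norm_num)]
      push_cast
      ring_nf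
    have h7 : Module.finrank ℝ E = k := by simp [E]
    rw [h7] at h1 h2
    rw [h4] at h3
    rw [h1, ← h3] at h2
    rw [h2, nsmul_eq_mul, Complex.real_smul]
    ring
  have h1 : ∫ x in Set.Ioi (0 : ℝ), ((x ^ ((k : ℝ) / 2 - 1) : ℝ) : ℂ) * Complex.exp (-(1 * x)) =
      (Real.Gamma (k / 2) : ℂ) := by
    rw [Real.Gamma_eq_integral (by positivity), ← integral_complex_ofReal]
    refine setIntegral_congr_fun measurableSet_Ioi fun x hx => ?_
    push_cast
    ring_nf
  have hC1 := hC 1 (by simp)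
  rw [h1, Complex.one_cpow, mul_one] at hC1
  have hpi : (Real.pi : ℂ) ^ (k / 2 : ℂ) ≠ 0 := by
    rw [Complex.cpow_ne_zero_iff]
    left
    exact_mod_cast Real.pi_pos.ne'
  have hC0 : C ≠ 0 := by
    rintro rfl
    rw [zero_mul] at hC1
    exact hpi hC1.symm
  have := hC a ha
  rw [← hC1] at this
  refine mul_left_cancel₀ hC0 ?_
  rw [this]
  ring

theorem integrableOn_rpow_mul_cexp_neg_mul {s : ℝ} (hs : -1 < s) {a : ℂ} (ha : 0 < a.re) :
    IntegrableOn (fun x : ℝ => ((x ^ s : ℝ) : ℂ) * Complex.exp (-(a * x))) (Set.Ioi 0) := by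
  have h := integrableOn_rpow_mul_exp_neg_mul_rpow (p := 1) hs one_pos ha
  refine Integrable.mono' h ?_ ?_
  · refine AEStronglyMeasurable.mul ?_ ?_
    · exact (Complex.measurable_ofReal.comp (by fun_prop)).aestronglyMeasurable
    · exact Continuous.aestronglyMeasurable (by fun_prop)
  · filter_upwards [ae_restrict_mem measurableSet_Ioi] with x hx
    have hx' : 0 < x := hx
    rw [norm_mul, Complex.norm_real, Complex.norm_exp, Real.norm_of_nonneg (by positivity)]
    simp

/-- Product Gaussians with complex coefficients. -/
theorem integral_cexp_neg_sum_mul_sq {N : ℕ} {b : Fin N → ℂ} (hb : ∀ j, 0 < (b j).re) :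
    ∫ w : Fin N → ℝ, Complex.exp (-∑ j, b j * (w j : ℂ) ^ 2) =
      ∏ j, (Real.pi : ℂ) ^ (1 / 2 : ℂ) * (b j) ^ (-(1 / 2 : ℂ)) := by
  simpa [ofReal_div_cpow Real.pi_pos (hb _)] using
    GaussianFourier.integral_cexp_neg_sum_mul_add hb fun _ => 0

theorem integrable_cexp_neg_sum_mul_sq {N : ℕ} {b : Fin N → ℂ} (hb : ∀ j, 0 < (b j).re) :
    Integrable fun w : Fin N → ℝ => Complex.exp (-∑ j, b j * (w j : ℂ) ^ 2) := by
  simpa using GaussianFourier.integrable_cexp_neg_sum_mul_add hb fun _ => 0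

/-! ### Symmetric matrices, the positive semidefinite cone and Schur complements -/

noncomputable section

theorem SymMat.ext_mat {N : ℕ} {X Y : SymMat N} (h : X.mat = Y.mat) : X = Y := by
  refine Subtype.ext (PiLp.ext fun p => ?_)
  exact congrFun (congrFun h p.1) p.2

/-- The element of `SymMat N` with the entries of a symmetric matrix. -/
def SymMat.ofMat {N : ℕ} (M : Matrix (Fin N) (Fin N) ℝ) (hM : M.IsSymm) : SymMat N :=
  ⟨WithLp.toLp 2 fun p => M p.1 p.2, fun i j => hM.apply j i⟩

@[simp]
theorem SymMat.mat_ofMat {N : ℕ} (M : Matrix (Fin N) (Fin N) ℝ) (hM : M.IsSymm) :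
    (SymMat.ofMat M hM).mat = M := rfl

/-- `SymMat.mat` as a linear map. -/
def SymMat.matₗ (N : ℕ) : SymMat N →ₗ[ℝ] Matrix (Fin N) (Fin N) ℝ where
  toFun := SymMat.mat
  map_add' := SymMat.mat_add
  map_smul' := SymMat.mat_smul

@[simp]
theorem SymMat.matₗ_apply {N : ℕ} (X : SymMat N) : SymMat.matₗ N X = X.mat := rfl

@[fun_prop]
theorem SymMat.continuous_mat {N : ℕ} : Continuous (SymMat.mat : SymMat N → _) :=
  (SymMat.matₗ N).continuous_of_finiteDimensional

theorem SymMat.mat_apply_comm {N : ℕ} (X : SymMat N) (i j : Fin N) : X.mat i j = X.mat j i :=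
  X.mat_isSymm.apply j i

theorem SymMat.isHermitian_mat {N : ℕ} (X : SymMat N) : X.mat.IsHermitian := by
  rw [Matrix.IsHermitian, Matrix.conjTranspose_eq_transpose_of_trivial]
  exact X.mat_isSymm

theorem SymMat.norm_sq_eq {N : ℕ} (X : SymMat N) : ‖X‖ ^ 2 = ∑ i, ∑ j, X.mat i j ^ 2 := by
  rw [← real_inner_self_eq_norm_sq, SymMat.inner_eq_trace]
  simp only [Matrix.trace, Matrix.diag_apply, Matrix.mul_apply]
  refine Finset.sum_congr rfl fun i _ => Finset.sum_congr rfl fun j _ => ?_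
  rw [X.mat_apply_comm j i, sq]

/-- The cone of positive semidefinite matrices in `Sym(N)`. -/
def psdCone (N : ℕ) : Set (SymMat N) := {X | X.mat.PosSemidef}

theorem mem_psdCone_iff {N : ℕ} {X : SymMat N} :
    X ∈ psdCone N ↔ ∀ x : Fin N → ℝ, 0 ≤ x ⬝ᵥ (X.mat *ᵥ x) := by
  change X.mat.PosSemidef ↔ _
  rw [Matrix.posSemidef_iff_dotProduct_mulVec]
  exact and_iff_right X.isHermitian_mat

theorem isClosed_psdCone (N : ℕ) : IsClosed (psdCone N) := by
  have : psdCone N = ⋂ x : Fin N → ℝ, {X : SymMat N | 0 ≤ x ⬝ᵥ (X.mat *ᵥ x)} := by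
    ext X
    simp [mem_psdCone_iff]
  rw [this]
  exact isClosed_iInter fun x => isClosed_le continuous_const (by fun_prop)

theorem convex_psdCone (N : ℕ) : Convex ℝ (psdCone N) := by
  intro X hX Y hY a b ha hb _
  change (a • X.mat + b • Y.mat).PosSemidef
  exact (hX.smul ha).add (hY.smul hb)

theorem finrank_symMat_zero : Module.finrank ℝ (SymMat 0) = 0 := by
  have : Subsingleton (SymMat 0) := ⟨fun X Y => SymMat.ext_mat (Subsingleton.elim _ _)⟩
  exact Module.finrank_zero_of_subsingleton

theorem volume_univ_symMat_zero : volume (Set.univ : Set (SymMat 0)) = 1 := by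
  have h := (stdOrthonormalBasis ℝ (SymMat 0)).measurePreserving_repr
  rw [← Set.preimage_univ (f := (stdOrthonormalBasis ℝ (SymMat 0)).repr),
    h.measure_preimage MeasurableSet.univ.nullMeasurableSet]
  have : IsEmpty (Fin (Module.finrank ℝ (SymMat 0))) := by
    rw [finrank_symMat_zero]
    infer_instance
  rw [volume_euclideanSpace_eq_dirac]
  simp

/-- The lower right block of a symmetric matrix. -/
def SymMat.tail {N : ℕ} (X : SymMat (N + 1)) : SymMat N :=
  SymMat.ofMat (X.mat.submatrix Fin.succ Fin.succ) (X.mat_isSymm.submatrix _)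

/-- The splitting of a symmetric matrix into its corner, the rest of its first row, and its lower
right block. The entries of the row are scaled by `√2`, as they occur twice in the matrix. -/
def splitLinear (N : ℕ) : SymMat (N + 1) →ₗ[ℝ]
    WithLp 2 (WithLp 2 (ℝ × EuclideanSpace ℝ (Fin N)) × SymMat N) where
  toFun X := WithLp.toLp 2 (WithLp.toLp 2 (X.mat 0 0, WithLp.toLp 2 fun j => √2 * X.mat 0 j.succ),
    X.tail)
  map_add' X Y := by
    simp only [SymMat.mat_add, Matrix.add_apply, mul_add]
    rfl
  map_smul' c X := by
    have : (fun j : Fin N => √2 * (c • X).mat 0 j.succ) =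
        c • fun j : Fin N => √2 * X.mat 0 j.succ := by
      ext j
      simp only [SymMat.mat_smul, Matrix.smul_apply, Pi.smul_apply, smul_eq_mul]
      ring
    rw [this]
    rfl

theorem norm_splitLinear {N : ℕ} (X : SymMat (N + 1)) : ‖splitLinear N X‖ = ‖X‖ := by
  rw [← sq_eq_sq₀ (norm_nonneg _) (norm_nonneg _), WithLp.prod_norm_sq_eq_of_L2,
    WithLp.prod_norm_sq_eq_of_L2, SymMat.norm_sq_eq X]
  change ‖X.mat 0 0‖ ^ 2 + ‖(WithLp.toLp 2 fun j => √2 * X.mat 0 j.succ :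
    EuclideanSpace ℝ (Fin N))‖ ^ 2 + ‖X.tail‖ ^ 2 = _
  have h1 : ‖X.tail‖ ^ 2 = ∑ i : Fin N, ∑ j : Fin N, X.mat i.succ j.succ ^ 2 :=
    SymMat.norm_sq_eq _
  have h2 : ∀ j : Fin N, X.mat j.succ 0 ^ 2 = X.mat 0 j.succ ^ 2 := fun j => by
    rw [X.mat_apply_comm]
  rw [h1, EuclideanSpace.norm_sq_eq]
  simp only [Fin.sum_univ_succ, Finset.sum_add_distrib, Real.norm_eq_abs, sq_abs, mul_pow,
    Real.sq_sqrt (show (0 : ℝ) ≤ 2 by norm_num), ← Finset.mul_sum, h2]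
  ring

theorem splitLinear_surjective (N : ℕ) : Function.Surjective (splitLinear N) := by
  intro p
  let v : Fin N → ℝ := fun j => p.fst.snd j / √2
  let M : Matrix (Fin (N + 1)) (Fin (N + 1)) ℝ := fun i j =>
    Fin.cases (Fin.cases p.fst.fst v j) (fun i' => Fin.cases (v i') (fun j' => p.snd.mat i' j') j) i
  have hM : M.IsSymm := by
    ext i j
    refine Fin.cases ?_ (fun i' => ?_) i <;> refine Fin.cases ?_ (fun j' => ?_) j
    · rfl
    · rfl
    · rfl
    · exact p.snd.mat_apply_comm j' i'
  refine ⟨SymMat.ofMat M hM, ?_⟩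
  have h1 : (fun j : Fin N => √2 * (SymMat.ofMat M hM).mat 0 j.succ) = p.fst.snd.ofLp := by
    ext j
    change √2 * (p.fst.snd j / √2) = p.fst.snd j
    field_simp
  have h2 : (SymMat.ofMat M hM).tail = p.snd := SymMat.ext_mat rfl
  simp only [splitLinear, LinearMap.coe_mk, AddHom.coe_mk, h1, h2]
  rfl

/-- `splitLinear` as an isometry. -/
def splitIsometry (N : ℕ) : SymMat (N + 1) ≃ₗᵢ[ℝ]
    WithLp 2 (WithLp 2 (ℝ × EuclideanSpace ℝ (Fin N)) × SymMat N) :=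
  LinearIsometryEquiv.ofSurjective ⟨splitLinear N, norm_splitLinear⟩ (splitLinear_surjective N)

/-- The measurable equivalence behind `splitIsometry`. -/
def splitEquiv (N : ℕ) : SymMat (N + 1) ≃ᵐ (ℝ × (Fin N → ℝ)) × SymMat N :=
  ((splitIsometry N).toMeasurableEquiv.trans
    (MeasurableEquiv.toLp 2 (WithLp 2 (ℝ × EuclideanSpace ℝ (Fin N)) × SymMat N)).symm).trans
    (MeasurableEquiv.prodCongr ((MeasurableEquiv.toLp 2 (ℝ × EuclideanSpace ℝ (Fin N))).symm.trans
      (MeasurableEquiv.prodCongr (MeasurableEquiv.refl ℝ) (MeasurableEquiv.toLp 2 _).symm))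
      (MeasurableEquiv.refl _))

theorem splitEquiv_apply {N : ℕ} (X : SymMat (N + 1)) :
    splitEquiv N X = ((X.mat 0 0, fun j => √2 * X.mat 0 j.succ), X.tail) := rfl

theorem measurePreserving_splitEquiv (N : ℕ) :
    MeasurePreserving (splitEquiv N) volume volume := by
  have h1 : MeasurePreserving (Prod.map id (WithLp.ofLp (p := 2)) ∘ WithLp.ofLp (p := 2) :
      WithLp 2 (ℝ × EuclideanSpace ℝ (Fin N)) → ℝ × (Fin N → ℝ)) volume volume :=
    ((MeasurePreserving.id _).prod (PiLp.volume_preserving_ofLp (Fin N))).comp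
      (WithLp.volume_preserving_ofLp _ _)
  exact (h1.prod (MeasurePreserving.id (volume : Measure (SymMat N)))).comp
    ((WithLp.volume_preserving_ofLp _ _).comp (splitIsometry N).measurePreserving)

theorem dotProduct_mulVec_split {N : ℕ} (X : SymMat (N + 1)) (t : ℝ) (y : Fin N → ℝ) :
    (Fin.cons t y : Fin (N + 1) → ℝ) ⬝ᵥ (X.mat *ᵥ Fin.cons t y) =
      X.mat 0 0 * t ^ 2 + 2 * t * ∑ j, X.mat 0 j.succ * y j + y ⬝ᵥ (X.tail.mat *ᵥ y) := by
  simp only [dotProduct, Matrix.mulVec, Fin.sum_univ_succ, Fin.cons_zero, Fin.cons_succ,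
    SymMat.tail, SymMat.mat_ofMat, Matrix.submatrix_apply, mul_add, Finset.sum_add_distrib]
  have : ∀ j : Fin N, X.mat j.succ 0 = X.mat 0 j.succ := fun j => X.mat_apply_comm _ _
  simp only [this, Finset.mul_sum]
  have h : ∑ j, y j * (X.mat 0 j.succ * t) = ∑ j, t * (X.mat 0 j.succ * y j) :=
    Finset.sum_congr rfl fun j _ => by ring
  have h' : ∑ j, 2 * t * (X.mat 0 j.succ * y j) = 2 * ∑ j, t * (X.mat 0 j.succ * y j) := by
    rw [Finset.mul_sum]
    exact Finset.sum_congr rfl fun j _ => by ring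
  rw [h, h']
  ring

/-- The rank one matrix `w wᵀ / (2 d)`. -/
def rankOne {N : ℕ} (d : ℝ) (w : Fin N → ℝ) : SymMat N :=
  SymMat.ofMat (Matrix.of fun i j => w i * w j / (2 * d)) (by
    ext i j
    simp [mul_comm])

theorem dotProduct_rankOne_mulVec {N : ℕ} (d : ℝ) (w y : Fin N → ℝ) :
    y ⬝ᵥ ((rankOne d w).mat *ᵥ y) = (∑ j, w j * y j) ^ 2 / (2 * d) := by
  have h : ∀ i j, (rankOne d w).mat i j = w i * w j / (2 * d) := fun _ _ => rfl
  rw [sq, Finset.sum_mul_sum, Finset.sum_div]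
  simp only [dotProduct, Matrix.mulVec, h, Finset.sum_div, Finset.mul_sum]
  refine Finset.sum_congr rfl fun i _ => Finset.sum_congr rfl fun j _ => ?_
  ring

/-- The Schur complement criterion for positive semidefiniteness. -/
theorem mem_psdCone_split {N : ℕ} {X : SymMat (N + 1)} (hd : 0 < X.mat 0 0) :
    X ∈ psdCone (N + 1) ↔
      X.tail - rankOne (X.mat 0 0) (fun j => √2 * X.mat 0 j.succ) ∈ psdCone N := by
  set d := X.mat 0 0 with hd'
  set w : Fin N → ℝ := fun j => √2 * X.mat 0 j.succ with hw
  -- Completing the square in the first variable.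
  have key : ∀ (t : ℝ) (y : Fin N → ℝ),
      (Fin.cons t y : Fin (N + 1) → ℝ) ⬝ᵥ (X.mat *ᵥ Fin.cons t y) =
        d * (t + (∑ j, X.mat 0 j.succ * y j) / d) ^ 2 +
          y ⬝ᵥ ((X.tail - rankOne d w).mat *ᵥ y) := by
    intro t y
    have h1 : (X.tail - rankOne d w).mat = X.tail.mat - (rankOne d w).mat := rfl
    have h2 : ∑ j, w j * y j = √2 * ∑ j, X.mat 0 j.succ * y j := by
      rw [Finset.mul_sum]
      exact Finset.sum_congr rfl fun j _ => by rw [hw]; ring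
    rw [dotProduct_mulVec_split, h1, Matrix.sub_mulVec, dotProduct_sub, dotProduct_rankOne_mulVec,
      h2, mul_pow, Real.sq_sqrt (by norm_num), ← hd']
    field_simp
    ring
  rw [mem_psdCone_iff, mem_psdCone_iff]
  constructor
  · intro h y
    have := h (Fin.cons (-((∑ j, X.mat 0 j.succ * y j) / d)) y)
    rw [key] at this
    simpa using this
  · intro h x
    rw [← Fin.cons_self_tail x, key]
    have := h (Fin.tail x)
    positivity

theorem notMem_psdCone_of_neg {N : ℕ} {X : SymMat (N + 1)} (hd : X.mat 0 0 < 0) :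
    X ∉ psdCone (N + 1) :=
  fun h => absurd (Matrix.PosSemidef.diag_nonneg h (i := 0)) (not_le.mpr hd)

end

/-! ### Siegel's integral at a diagonal matrix -/

noncomputable section

/-- The closed form of the integral of `exp (- tr X)` over the positive semidefinite cone of
`Sym(N)`; see `integral_laplaceIntegrand`. -/
def siegelConst (N : ℕ) : ℝ :=
  (2 : ℝ) ^ ((N : ℝ) * (N - 1) / 4) * multivariateGamma N (((N : ℝ) + 1) / 2)

theorem siegelConst_pos (N : ℕ) : 0 < siegelConst N := by
  rw [siegelConst, multivariateGamma]
  have : 0 < ∏ j ∈ Finset.range N, Real.Gamma (((N : ℝ) + 1) / 2 - (j : ℝ) / 2) := by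
    refine Finset.prod_pos fun j hj => Real.Gamma_pos_of_pos ?_
    have : (j : ℝ) + 1 ≤ N := by exact_mod_cast Finset.mem_range.mp hj
    linarith
  have := Real.pi_pos
  positivity

theorem siegelConst_zero : siegelConst 0 = 1 := by
  simp [siegelConst, multivariateGamma]

/-- The recursion produced by integrating out the first row of a symmetric matrix. -/
theorem siegelConst_succ (N : ℕ) : siegelConst (N + 1) =
    siegelConst N * ((2 * Real.pi) ^ ((N : ℝ) / 2) * Real.Gamma (((N : ℝ) + 2) / 2)) := by
  have hpi := Real.pi_pos
  have h1 : ∀ x : ℝ, 0 < x → x ^ (((N + 1 : ℕ) : ℝ) * ((N + 1 : ℕ) - 1) / 4) =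
      x ^ ((N : ℝ) * (N - 1) / 4) * x ^ ((N : ℝ) / 2) := by
    intro x hx
    rw [← Real.rpow_add hx]
    congr 1
    push_cast
    ring
  have h2 : ∀ j : ℕ, (((N + 1 : ℕ) : ℝ) + 1) / 2 - ((j + 1 : ℕ) : ℝ) / 2 =
      ((N : ℝ) + 1) / 2 - (j : ℝ) / 2 := by
    intro j
    push_cast
    ring
  have h3 : (((N + 1 : ℕ) : ℝ) + 1) / 2 - ((0 : ℕ) : ℝ) / 2 = ((N : ℝ) + 2) / 2 := by
    push_cast
    ring
  rw [siegelConst, siegelConst, multivariateGamma, multivariateGamma, Finset.prod_range_succ',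
    h1 2 (by norm_num), h1 _ hpi, Real.mul_rpow (by norm_num) hpi.le, h3]
  simp only [h2]
  ring

/-- The factor of the Laplace integrand that depends on the first row of the matrix. -/
def rowFactor {N : ℕ} (a₀ : ℂ) (a : Fin N → ℂ) (p : ℝ × (Fin N → ℝ)) : ℂ :=
  (Set.Ioi (0 : ℝ)).indicator (fun d : ℝ => Complex.exp (-(a₀ * d))) p.1 *
    Complex.exp (-∑ j, a j / (2 * p.1) * (p.2 j : ℂ) ^ 2)

theorem measurable_rowFactor {N : ℕ} (a₀ : ℂ) (a : Fin N → ℂ) : Measurable (rowFactor a₀ a) := by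
  refine Measurable.mul ?_ (by fun_prop)
  exact ((by fun_prop : Measurable fun d : ℝ => Complex.exp (-(a₀ * d))).indicator
    measurableSet_Ioi).comp measurable_fst

theorem re_div_two_mul_pos {z : ℂ} (hz : 0 < z.re) {d : ℝ} (hd : 0 < d) :
    0 < (z / (2 * d)).re := by
  have : z / (2 * d) = ((1 / (2 * d) : ℝ) : ℂ) * z := by
    push_cast
    ring
  rw [this, Complex.re_ofReal_mul]
  positivity

theorem integral_rowFactor_row {N : ℕ} (a₀ : ℂ) {a : Fin N → ℂ} (ha : ∀ j, 0 < (a j).re) (d : ℝ) :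
    ∫ w, rowFactor a₀ a (d, w) =
      (Set.Ioi (0 : ℝ)).indicator (fun d : ℝ => ((d ^ ((N : ℝ) / 2) : ℝ) : ℂ) *
        Complex.exp (-(a₀ * d))) d *
        (((2 * Real.pi) ^ ((N : ℝ) / 2) : ℝ) * ∏ j, a j ^ (-(1 / 2 : ℂ))) := by
  by_cases hd : 0 < d
  swap
  · simp [rowFactor, hd]
  have hpi := Real.pi_pos
  have h1 : ∀ j, (Real.pi : ℂ) ^ (1 / 2 : ℂ) * (a j / (2 * d)) ^ (-(1 / 2 : ℂ)) =
      (((2 * Real.pi) ^ (1 / 2 : ℝ) * d ^ (1 / 2 : ℝ) : ℝ) : ℂ) * a j ^ (-(1 / 2 : ℂ)) := by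
    intro j
    have h2 : a j / (2 * d) = (((2 * d)⁻¹ : ℝ) : ℂ) * a j := by
      push_cast
      ring
    have h3 : (1 / 2 : ℂ) = ((1 / 2 : ℝ) : ℂ) := by norm_num
    rw [h2, ofReal_mul_cpow (by positivity) (ne_zero_of_re_pos (ha j)), ← mul_assoc]
    congr 1
    rw [h3, ← Complex.ofReal_neg, ← Complex.ofReal_cpow hpi.le,
      ← Complex.ofReal_cpow (by positivity), ← Complex.ofReal_mul]
    congr 1
    rw [Real.rpow_neg (by positivity), Real.inv_rpow (by positivity), inv_inv,
      Real.mul_rpow (by norm_num) hd.le, Real.mul_rpow (by norm_num) hpi.le]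
    ring
  have h4 : ∀ x : ℝ, 0 < x → (x ^ (1 / 2 : ℝ)) ^ N = x ^ ((N : ℝ) / 2) := by
    intro x hx
    rw [← Real.rpow_natCast, ← Real.rpow_mul hx.le]
    congr 1
    ring
  simp only [rowFactor, Set.indicator_of_mem (Set.mem_Ioi.mpr hd)]
  rw [integral_const_mul, integral_cexp_neg_sum_mul_sq fun j => re_div_two_mul_pos (ha j) hd,
    Finset.prod_congr rfl fun j _ => h1 j, Finset.prod_mul_distrib, Finset.prod_const,
    Finset.card_univ, Fintype.card_fin, ← Complex.ofReal_pow, mul_pow, h4 _ hd,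
    h4 _ (by positivity)]
  push_cast
  ring

theorem norm_rowFactor {N : ℕ} (a₀ : ℂ) (a : Fin N → ℂ) (p : ℝ × (Fin N → ℝ)) :
    ((‖rowFactor a₀ a p‖ : ℝ) : ℂ) = rowFactor (a₀.re : ℂ) (fun j => ((a j).re : ℂ)) p := by
  by_cases hd : 0 < p.1
  swap
  · simp [rowFactor, hd]
  simp only [rowFactor, Set.indicator_of_mem (Set.mem_Ioi.mpr hd), norm_mul, Complex.norm_exp]
  push_cast
  congr 2
  · simp
  · rw [Complex.neg_re, Complex.re_sum]
    push_cast
    congr 1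
    refine Finset.sum_congr rfl fun j _ => ?_
    have : a j / (2 * p.1) * (p.2 j : ℂ) ^ 2 =
        ((1 / (2 * p.1) * p.2 j ^ 2 : ℝ) : ℂ) * a j := by
      push_cast
      ring
    rw [this, Complex.re_ofReal_mul]
    push_cast
    ring

theorem integrable_rowFactor {N : ℕ} {a₀ : ℂ} {a : Fin N → ℂ} (ha₀ : 0 < a₀.re)
    (ha : ∀ j, 0 < (a j).re) : Integrable (rowFactor a₀ a) := by
  rw [Measure.volume_eq_prod, integrable_prod_iff (measurable_rowFactor a₀ a).aestronglyMeasurable]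
  constructor
  · refine Filter.Eventually.of_forall fun d => ?_
    by_cases hd : 0 < d
    · simp only [rowFactor]
      exact (integrable_cexp_neg_sum_mul_sq fun j => re_div_two_mul_pos (ha j) hd).const_mul _
    · simp [rowFactor, hd]
  · have h : ∀ d : ℝ, ((∫ w, ‖rowFactor a₀ a (d, w)‖ : ℝ) : ℂ) =
        (Set.Ioi (0 : ℝ)).indicator (fun d : ℝ => ((d ^ ((N : ℝ) / 2) : ℝ) : ℂ) *
          Complex.exp (-((a₀.re : ℂ) * d))) d *
          (((2 * Real.pi) ^ ((N : ℝ) / 2) : ℝ) * ∏ j, ((a j).re : ℂ) ^ (-(1 / 2 : ℂ))) := by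
      intro d
      rw [← integral_complex_ofReal, ← integral_rowFactor_row _ (by simpa using ha)]
      simp only [norm_rowFactor]
    have h2 : Integrable fun d : ℝ => ((∫ w, ‖rowFactor a₀ a (d, w)‖ : ℝ) : ℂ) := by
      simp only [h]
      refine Integrable.mul_const ?_ _
      rw [integrable_indicator_iff measurableSet_Ioi]
      refine integrableOn_rpow_mul_cexp_neg_mul ?_ (by simpa using ha₀)
      have : (0 : ℝ) ≤ (N : ℝ) / 2 := by positivity
      linarith
    simpa using h2.re

theorem integral_rowFactor {N : ℕ} {a₀ : ℂ} {a : Fin N → ℂ} (ha₀ : 0 < a₀.re)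
    (ha : ∀ j, 0 < (a j).re) : ∫ p, rowFactor a₀ a p =
      (((2 * Real.pi) ^ ((N : ℝ) / 2) * Real.Gamma (((N : ℝ) + 2) / 2) : ℝ) : ℂ) *
        (a₀ ^ (-(((N : ℂ) + 2) / 2)) * ∏ j, a j ^ (-(1 / 2 : ℂ))) := by
  have h := integrable_rowFactor ha₀ ha
  rw [Measure.volume_eq_prod] at h ⊢
  rw [integral_prod _ h]
  simp only [integral_rowFactor_row a₀ ha]
  rw [integral_mul_const, integral_indicator measurableSet_Ioi]
  have h1 := integral_rpow_mul_cexp_neg_mul (k := N + 2) (by omega) ha₀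
  have h2 : (((N + 2 : ℕ) : ℝ) / 2 - 1) = (N : ℝ) / 2 := by
    push_cast
    ring
  rw [h2] at h1
  rw [h1]
  push_cast
  ring

theorem measurable_rankOne {N : ℕ} :
    Measurable fun p : ℝ × (Fin N → ℝ) => rankOne p.1 p.2 := by
  have h : (fun p : ℝ × (Fin N → ℝ) => rankOne p.1 p.2) =
      fun p => (p.1)⁻¹ • rankOne 1 p.2 := by
    ext1 p
    refine SymMat.ext_mat ?_
    ext i j
    rw [SymMat.mat_smul]
    change p.2 i * p.2 j / (2 * p.1) = p.1⁻¹ * (p.2 i * p.2 j / (2 * 1))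
    by_cases hp : p.1 = 0
    · simp [hp]
    · field_simp
  rw [h]
  have h1 : Continuous fun w : Fin N → ℝ => rankOne 1 w := by
    refine Continuous.subtype_mk ?_ _
    refine (PiLp.continuous_toLp 2 _).comp (continuous_pi fun p => ?_)
    change Continuous fun w : Fin N → ℝ => w p.1 * w p.2 / (2 * 1)
    fun_prop
  exact (measurable_fst.inv).smul (h1.measurable.comp measurable_snd)

/-- The parametrization of symmetric matrices by the first row and the Schur complement of the
corner. -/
def schurMap (N : ℕ) (p : (ℝ × (Fin N → ℝ)) × SymMat N) : SymMat (N + 1) :=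
  (splitEquiv N).symm (p.1, p.2 + rankOne p.1.1 p.1.2)

/-- `schurMap` is an isometry after a shear, so it has no Jacobian. -/
theorem measurePreserving_schurMap (N : ℕ) :
    MeasurePreserving (schurMap N) volume volume := by
  have h : MeasurePreserving (fun p : (ℝ × (Fin N → ℝ)) × SymMat N =>
      (p.1, p.2 + rankOne p.1.1 p.1.2)) volume volume := by
    refine (MeasurePreserving.id volume).skew_product
      (g := fun (p : ℝ × (Fin N → ℝ)) (Y : SymMat N) => Y + rankOne p.1 p.2) ?_ ?_
    · exact measurable_snd.add (measurable_rankOne.comp measurable_fst)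
    · exact Filter.Eventually.of_forall fun p => map_add_right_eq_self _ _
  exact ((measurePreserving_splitEquiv N).symm).comp h

theorem schurMap_spec {N : ℕ} (p : (ℝ × (Fin N → ℝ)) × SymMat N) :
    (schurMap N p).mat 0 0 = p.1.1 ∧ (fun j => √2 * (schurMap N p).mat 0 (Fin.succ j)) = p.1.2 ∧
      (schurMap N p).tail = p.2 + rankOne p.1.1 p.1.2 := by
  have h := splitEquiv_apply (schurMap N p)
  rw [schurMap, MeasurableEquiv.apply_symm_apply, ← schurMap] at h
  exact ⟨(congrArg (fun x => x.1.1) h).symm, (congrArg (fun x => x.1.2) h).symm,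
    (congrArg (fun x => x.2) h).symm⟩

/-- The Laplace integrand on the positive semidefinite cone at a diagonal matrix. -/
def diagLaplace {N : ℕ} (a : Fin N → ℂ) : SymMat N → ℂ :=
  (psdCone N).indicator fun X => Complex.exp (-∑ j, a j * X.mat j j)

theorem measurable_diagLaplace {N : ℕ} (a : Fin N → ℂ) : Measurable (diagLaplace a) := by
  refine Measurable.indicator ?_ (isClosed_psdCone N).measurableSet
  exact Continuous.measurable (by fun_prop)

/-- In Schur complement coordinates the Laplace integrand factors. The hypothesis excludes only a
null set. -/
theorem diagLaplace_schurMap {N : ℕ} (a : Fin (N + 1) → ℂ) {p : (ℝ × (Fin N → ℝ)) × SymMat N}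
    (hp : p.1.1 ≠ 0) : diagLaplace a (schurMap N p) =
      rowFactor (a 0) (fun j => a j.succ) p.1 * diagLaplace (fun j => a j.succ) p.2 := by
  obtain ⟨h0, h1, h2⟩ := schurMap_spec p
  set X := schurMap N p with hX
  rcases lt_or_gt_of_ne hp with hneg | hpos
  · rw [← h0] at hneg
    have : ¬ 0 < p.1.1 := by rw [← h0]; exact not_lt.mpr hneg.le
    simp [diagLaplace, notMem_psdCone_of_neg hneg, rowFactor, this]
  · have hpos' : 0 < X.mat 0 0 := by rwa [h0]
    have hiff : X ∈ psdCone (N + 1) ↔ p.2 ∈ psdCone N := by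
      rw [mem_psdCone_split hpos', h1, h0, h2, add_sub_cancel_right]
    by_cases hmem : p.2 ∈ psdCone N
    · simp only [diagLaplace, rowFactor, Set.indicator_of_mem hmem,
        Set.indicator_of_mem (hiff.mpr hmem), Set.indicator_of_mem (Set.mem_Ioi.mpr hpos),
        ← Complex.exp_add]
      congr 1
      have hjj : ∀ j : Fin N, X.mat j.succ j.succ =
          p.2.mat j j + p.1.2 j * p.1.2 j / (2 * p.1.1) := fun j => by
        have : X.tail.mat j j = (p.2 + rankOne p.1.1 p.1.2).mat j j := by rw [h2]
        exact this
      rw [Fin.sum_univ_succ, h0]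
      simp only [hjj]
      rw [neg_add, add_assoc]
      congr 1
      rw [← neg_add, ← Finset.sum_add_distrib]
      congr 1
      refine Finset.sum_congr rfl fun j _ => ?_
      push_cast
      ring
    · simp [diagLaplace, hmem, mt hiff.mp hmem]

/-- Siegel's integral at a diagonal matrix with complex entries, by induction on the size: the first
row contributes `a₀ ^ (-(N + 2) / 2)` and raises the exponents of the other entries by `1 / 2`. -/
theorem integral_diagLaplace (N : ℕ) : ∀ a : Fin N → ℂ, (∀ j, 0 < (a j).re) →
    Integrable (diagLaplace a) ∧ ∫ X, diagLaplace a X =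
      (siegelConst N : ℂ) * ∏ j, a j ^ (-(((N : ℂ) + 1) / 2)) := by
  induction N with
  | zero =>
    intro a _
    have h : diagLaplace a = fun _ => 1 := by
      ext X
      have : X ∈ psdCone 0 := mem_psdCone_iff.mpr fun x => by simp
      simp [diagLaplace, this]
    have : IsFiniteMeasure (volume : Measure (SymMat 0)) :=
      ⟨by rw [volume_univ_symMat_zero]; exact ENNReal.one_lt_top⟩
    rw [h]
    refine ⟨integrable_const _, ?_⟩
    rw [integral_const, Measure.real, volume_univ_symMat_zero]
    simp [siegelConst_zero]
  | succ N ih =>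
    intro a ha
    obtain ⟨hint, hval⟩ := ih (fun j => a j.succ) fun j => ha _
    have hae : (fun p => diagLaplace a (schurMap N p)) =ᵐ[volume]
        fun p => rowFactor (a 0) (fun j => a j.succ) p.1 *
          diagLaplace (fun j => a j.succ) p.2 := by
      have h1 : ∀ᵐ d : ℝ, d ≠ 0 := Measure.ae_ne volume 0
      have h2 := (Measure.quasiMeasurePreserving_fst (μ := (volume : Measure (ℝ × (Fin N → ℝ))))
        (ν := (volume : Measure (SymMat N)))).ae
        ((Measure.quasiMeasurePreserving_fst (μ := (volume : Measure ℝ))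
          (ν := (volume : Measure (Fin N → ℝ)))).ae h1)
      filter_upwards [h2] with p hp
      exact diagLaplace_schurMap a hp
    have hrow := integrable_rowFactor (ha 0) (a := fun j => a j.succ) fun j => ha _
    have hT := measurePreserving_schurMap N
    have hm := (measurable_diagLaplace a).aestronglyMeasurable (μ := volume)
    constructor
    · rw [← hT.integrable_comp hm]
      exact (hrow.mul_prod hint).congr hae.symm
    · have h3 : ∫ X, diagLaplace a X = ∫ p, diagLaplace a (schurMap N p) := by
        rw [← hT.map_eq, integral_map hT.measurable.aemeasurable]
        rw [hT.map_eq]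
        exact hm
      rw [h3, integral_congr_ae hae, Measure.volume_eq_prod, integral_prod_mul, hval,
        integral_rowFactor (ha 0) fun j => ha _, siegelConst_succ, Fin.prod_univ_succ]
      have h4 : -((((N + 1 : ℕ) : ℂ) + 1) / 2) = -(((N : ℂ) + 2) / 2) := by
        push_cast
        ring
      have h5 : ∀ j : Fin N, a j.succ ^ (-((((N + 1 : ℕ) : ℂ) + 1) / 2)) =
          a j.succ ^ (-(((N : ℂ) + 1) / 2)) * a j.succ ^ (-(1 / 2 : ℂ)) := fun j => by
        rw [← Complex.cpow_add _ _ (ne_zero_of_re_pos (ha _))]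
        congr 1
        push_cast
        ring
      rw [Finset.prod_congr rfl fun j _ => h5 j, Finset.prod_mul_distrib, h4]
      push_cast
      ring

end

/-! ### The Fourier transform of a Wishart density -/

noncomputable section

theorem posSemidef_sqrt {N : ℕ} (M : Matrix (Fin N) (Fin N) ℝ) : (CFC.sqrt M).PosSemidef :=
  Matrix.nonneg_iff_posSemidef.mp (CFC.sqrt_nonneg M)

theorem sqrt_mul_sqrt {N : ℕ} {M : Matrix (Fin N) (Fin N) ℝ} (hM : M.PosSemidef) :
    CFC.sqrt M * CFC.sqrt M = M :=
  CFC.sqrt_mul_sqrt_self M (Matrix.nonneg_iff_posSemidef.mpr hM)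

theorem transpose_sqrt {N : ℕ} (M : Matrix (Fin N) (Fin N) ℝ) : (CFC.sqrt M)ᵀ = CFC.sqrt M := by
  have := (posSemidef_sqrt M).isHermitian
  rwa [Matrix.IsHermitian, Matrix.conjTranspose_eq_transpose_of_trivial] at this

theorem isUnit_sqrt {N : ℕ} {M : Matrix (Fin N) (Fin N) ℝ} (hM : M.PosDef) :
    IsUnit (CFC.sqrt M) := by
  have h : CFC.sqrt M * (CFC.sqrt M * M⁻¹) = 1 := by
    rw [← mul_assoc, sqrt_mul_sqrt hM.posSemidef,
      Matrix.mul_nonsing_inv _ ((Matrix.isUnit_iff_isUnit_det _).mp hM.isUnit)]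
  exact IsUnit.of_mul_eq_one _ h

/-- The congruence transformation `X ↦ G X Gᵀ` of `Sym(N)`. -/
def congruence {N : ℕ} (G : Matrix (Fin N) (Fin N) ℝ) : SymMat N →ₗ[ℝ] SymMat N where
  toFun X := SymMat.ofMat (G * X.mat * Gᵀ) (by
    rw [Matrix.IsSymm, Matrix.transpose_mul, Matrix.transpose_mul, Matrix.transpose_transpose,
      X.mat_isSymm.eq, mul_assoc])
  map_add' X Y := SymMat.ext_mat (by
    change G * (X.mat + Y.mat) * Gᵀ = G * X.mat * Gᵀ + G * Y.mat * Gᵀ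
    rw [mul_add, add_mul])
  map_smul' c X := SymMat.ext_mat (by
    change G * (c • X.mat) * Gᵀ = c • (G * X.mat * Gᵀ)
    rw [mul_smul_comm, smul_mul_assoc])

theorem mat_congruence {N : ℕ} (G : Matrix (Fin N) (Fin N) ℝ) (X : SymMat N) :
    (congruence G X).mat = G * X.mat * Gᵀ := rfl

theorem congruence_mul_apply {N : ℕ} (G H : Matrix (Fin N) (Fin N) ℝ) (X : SymMat N) :
    congruence (G * H) X = congruence G (congruence H X) :=
  SymMat.ext_mat (by simp only [mat_congruence, Matrix.transpose_mul, mul_assoc])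

theorem congruence_one_apply {N : ℕ} (X : SymMat N) :
    congruence (1 : Matrix (Fin N) (Fin N) ℝ) X = X :=
  SymMat.ext_mat (by simp [mat_congruence])

theorem congruence_mem_psdCone_iff {N : ℕ} {G : Matrix (Fin N) (Fin N) ℝ} (hG : IsUnit G)
    {X : SymMat N} : congruence G X ∈ psdCone N ↔ X ∈ psdCone N := by
  change (G * X.mat * Gᵀ).PosSemidef ↔ X.mat.PosSemidef
  rw [← Matrix.conjTranspose_eq_transpose_of_trivial, ← Matrix.star_eq_conjTranspose]
  exact hG.posSemidef_star_right_conjugate_iff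

theorem norm_congruence {N : ℕ} {U : Matrix (Fin N) (Fin N) ℝ} (hU : Uᵀ * U = 1)
    (X : SymMat N) : ‖congruence U X‖ = ‖X‖ := by
  rw [← sq_eq_sq₀ (norm_nonneg _) (norm_nonneg _), ← real_inner_self_eq_norm_sq,
    ← real_inner_self_eq_norm_sq, SymMat.inner_eq_trace, SymMat.inner_eq_trace, mat_congruence,
    show U * X.mat * Uᵀ * (U * X.mat * Uᵀ) = U * X.mat * (Uᵀ * U) * (X.mat * Uᵀ) by
      simp only [mul_assoc], hU, mul_one, Matrix.trace_mul_comm, mul_assoc, ← mul_assoc Uᵀ,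
    hU, one_mul]

theorem measurePreserving_congruence {N : ℕ} {U : Matrix (Fin N) (Fin N) ℝ} (hU : Uᵀ * U = 1) :
    MeasurePreserving (congruence U) volume volume := by
  let e : SymMat N ≃ₗᵢ[ℝ] SymMat N :=
    LinearIsometryEquiv.ofSurjective ⟨congruence U, norm_congruence hU⟩ fun X =>
      ⟨congruence Uᵀ X, by
        change congruence U (congruence Uᵀ X) = X
        rw [← congruence_mul_apply, mul_eq_one_comm.mp hU, congruence_one_apply]⟩
  exact e.measurePreserving

/-- The Laplace integrand `exp (- (α tr X + β tr (H X)))` on the positive semidefinite cone. -/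
def laplaceIntegrand {N : ℕ} (α β : ℂ) (H : Matrix (Fin N) (Fin N) ℝ) : SymMat N → ℂ :=
  (psdCone N).indicator fun X =>
    Complex.exp (-(α * (X.mat.trace : ℝ) + β * ((H * X.mat).trace : ℝ)))

/-- The Laplace integral on the positive semidefinite cone, diagonalized by an orthogonal
change of variables. -/
theorem integral_laplaceIntegrand {N : ℕ} {α β : ℂ} {H : Matrix (Fin N) (Fin N) ℝ}
    (hH : H.IsHermitian) (hpos : ∀ j, 0 < (α + β * hH.eigenvalues j).re) :
    Integrable (laplaceIntegrand α β H) ∧ ∫ X, laplaceIntegrand α β H X =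
      (siegelConst N : ℂ) * ∏ j, (α + β * hH.eigenvalues j) ^ (-(((N : ℂ) + 1) / 2)) := by
  set U : Matrix (Fin N) (Fin N) ℝ := (hH.eigenvectorUnitary : Matrix (Fin N) (Fin N) ℝ) with hUdef
  have hUU : Uᵀ * U = 1 := by
    rw [← Matrix.conjTranspose_eq_transpose_of_trivial, ← Matrix.star_eq_conjTranspose]
    exact Unitary.coe_star_mul_self _
  have hUU' : Uᵀᵀ * Uᵀ = 1 := by
    rw [Matrix.transpose_transpose]
    exact mul_eq_one_comm.mp hUU
  have hspec : H = U * Matrix.diagonal hH.eigenvalues * Uᵀ := by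
    conv_lhs => rw [hH.spectral_theorem]
    rw [Unitary.conjStarAlgAut_apply, Matrix.star_eq_conjTranspose,
      Matrix.conjTranspose_eq_transpose_of_trivial]
    rfl
  have hunit : IsUnit Uᵀ := IsUnit.of_mul_eq_one _ hUU
  have hcomp : ∀ X, laplaceIntegrand α β H X =
      diagLaplace (fun j => α + β * hH.eigenvalues j) (congruence Uᵀ X) := by
    intro X
    by_cases hX : X ∈ psdCone N
    · simp only [laplaceIntegrand, diagLaplace, Set.indicator_of_mem hX,
        Set.indicator_of_mem ((congruence_mem_psdCone_iff hunit).mpr hX)]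
      have h1 : X.mat.trace = ∑ j, (congruence Uᵀ X).mat j j := by
        change _ = (Uᵀ * X.mat * Uᵀᵀ).trace
        rw [Matrix.trace_mul_comm, ← mul_assoc, hUU', one_mul]
      have h2 : (H * X.mat).trace = ∑ j, hH.eigenvalues j * (congruence Uᵀ X).mat j j := by
        have : ∑ j, hH.eigenvalues j * (congruence Uᵀ X).mat j j =
            (Matrix.diagonal hH.eigenvalues * (Uᵀ * X.mat * Uᵀᵀ)).trace := by
          simp [Matrix.trace, Matrix.diagonal_mul, mat_congruence]
        rw [this, Matrix.transpose_transpose, ← mul_assoc, Matrix.trace_mul_comm _ U, ← mul_assoc,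
          ← mul_assoc, ← hspec]
      rw [h1, h2]
      push_cast
      congr 2
      rw [Finset.mul_sum, Finset.mul_sum, ← Finset.sum_add_distrib]
      exact Finset.sum_congr rfl fun j _ => by ring
    · simp [laplaceIntegrand, diagLaplace, hX, mt (congruence_mem_psdCone_iff hunit).mp hX]
  obtain ⟨hint, hval⟩ := integral_diagLaplace N (fun j => α + β * hH.eigenvalues j) hpos
  have hT := measurePreserving_congruence hUU'
  have hm := (measurable_diagLaplace (fun j => α + β * hH.eigenvalues j)).aestronglyMeasurable
    (μ := volume)
  have hfun : laplaceIntegrand α β H =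
      diagLaplace (fun j => α + β * hH.eigenvalues j) ∘ congruence Uᵀ := funext hcomp
  constructor
  · rw [hfun, hT.integrable_comp hm]
    exact hint
  · have h3 := integral_map (μ := volume) hT.measurable.aemeasurable
      (f := diagLaplace fun j => α + β * hH.eigenvalues j) (by rw [hT.map_eq]; exact hm)
    rw [hT.map_eq] at h3
    rw [← hval, h3]
    exact integral_congr_ae (Filter.Eventually.of_forall hcomp)

theorem measurableEmbedding_of_det_ne_zero {E : Type*} [NormedAddCommGroup E] [NormedSpace ℝ E]
    [FiniteDimensional ℝ E] [MeasurableSpace E] [BorelSpace E] {L : E →ₗ[ℝ] E}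
    (hL : LinearMap.det L ≠ 0) : MeasurableEmbedding L :=
  let e := LinearEquiv.ofIsUnitDet (f := L) (v := Module.finBasis ℝ E) (v' := Module.finBasis ℝ E)
    (by rw [LinearMap.det_toMatrix]; exact hL.isUnit)
  e.toContinuousLinearEquiv.toHomeomorph.measurableEmbedding

theorem integral_comp_linearMap {E F : Type*} [NormedAddCommGroup E] [NormedSpace ℝ E]
    [FiniteDimensional ℝ E] [MeasurableSpace E] [BorelSpace E] [NormedAddCommGroup F]
    [NormedSpace ℝ F] (μ : Measure E) [μ.IsAddHaarMeasure] {L : E →ₗ[ℝ] E}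
    (hL : LinearMap.det L ≠ 0) (f : E → F) :
    ∫ x, f (L x) ∂μ = |LinearMap.det L|⁻¹ • ∫ x, f x ∂μ := by
  have hemb := measurableEmbedding_of_det_ne_zero hL
  have h := hemb.integral_map (μ := μ) f
  rw [Measure.map_linearMap_addHaar_eq_smul_addHaar μ hL, integral_smul_measure] at h
  rw [← h, ENNReal.toReal_ofReal (abs_nonneg _), abs_inv]

theorem integrable_comp_linearMap_iff {E F : Type*} [NormedAddCommGroup E] [NormedSpace ℝ E]
    [FiniteDimensional ℝ E] [MeasurableSpace E] [BorelSpace E] [NormedAddCommGroup F]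
    (μ : Measure E) [μ.IsAddHaarMeasure] {L : E →ₗ[ℝ] E}
    (hL : LinearMap.det L ≠ 0) (f : E → F) :
    Integrable (fun x => f (L x)) μ ↔ Integrable f μ := by
  have hemb := measurableEmbedding_of_det_ne_zero hL
  have h := hemb.integrable_map_iff (μ := μ) (g := f)
  rw [Measure.map_linearMap_addHaar_eq_smul_addHaar μ hL,
    integrable_smul_measure (by simpa using hL) ENNReal.ofReal_ne_top] at h
  exact h.symm

theorem det_congruence_ne_zero {N : ℕ} {G : Matrix (Fin N) (Fin N) ℝ} (hG : IsUnit G) :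
    LinearMap.det (congruence G) ≠ 0 := by
  obtain ⟨H, hH⟩ := hG.exists_right_inv
  have : congruence G ∘ₗ congruence H = LinearMap.id := by
    ext1 X
    rw [LinearMap.comp_apply, ← congruence_mul_apply, hH, congruence_one_apply, LinearMap.id_apply]
  have h2 := congrArg LinearMap.det this
  rw [LinearMap.det_comp, LinearMap.det_id] at h2
  exact left_ne_zero_of_mul (by rw [h2]; exact one_ne_zero)

/-- The Jacobian of `X ↦ √P X √P` is `det P ^ ((N + 1) / 2)`: substitute in the integral of
`exp (- tr X)` and compare with the Laplace integral at `P`. -/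
theorem abs_det_congruence_sqrt {N : ℕ} {P : Matrix (Fin N) (Fin N) ℝ} (hP : P.PosDef) :
    |LinearMap.det (congruence (CFC.sqrt P))| = P.det ^ (((N : ℝ) + 1) / 2) := by
  have hu := isUnit_sqrt hP
  have hL := det_congruence_ne_zero hu
  have h0 : (0 : Matrix (Fin N) (Fin N) ℝ).IsHermitian := Matrix.isHermitian_zero
  have h1 := (integral_laplaceIntegrand (α := 1) (β := 0) h0 (by simp)).2
  have hPh := hP.isHermitian
  have h2 := (integral_laplaceIntegrand (α := 0) (β := 1) hPh
    (by simpa using hP.eigenvalues_pos)).2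
  have h3 := integral_comp_linearMap volume hL (laplaceIntegrand 1 0 0)
  have h4 : ∀ X, laplaceIntegrand 1 0 0 (congruence (CFC.sqrt P) X) =
      laplaceIntegrand 0 1 P X := by
    intro X
    by_cases hX : X ∈ psdCone N
    · simp only [laplaceIntegrand, Set.indicator_of_mem hX,
        Set.indicator_of_mem ((congruence_mem_psdCone_iff hu).mpr hX)]
      rw [mat_congruence, transpose_sqrt, Matrix.trace_mul_comm, ← mul_assoc,
        sqrt_mul_sqrt hP.posSemidef]
      simp
    · simp [laplaceIntegrand, hX, mt (congruence_mem_psdCone_iff hu).mp hX]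
  simp only [h4] at h3
  rw [h1, h2] at h3
  have hC : (siegelConst N : ℂ) ≠ 0 := Complex.ofReal_ne_zero.mpr (siegelConst_pos N).ne'
  have hdet : 0 < P.det := hP.det_pos
  have h5 : ∏ j, ((0 : ℂ) + 1 * hPh.eigenvalues j) ^ (-(((N : ℂ) + 1) / 2)) =
      ((P.det ^ (-(((N : ℝ) + 1) / 2)) : ℝ) : ℂ) := by
    rw [hPh.det_eq_prod_eigenvalues]
    simp only [RCLike.ofReal_real_eq_id, id_eq]
    rw [← Real.finsetProd_rpow _ _ fun j _ => (hP.eigenvalues_pos j).le]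
    push_cast
    refine Finset.prod_congr rfl fun j _ => ?_
    rw [Complex.ofReal_cpow (hP.eigenvalues_pos j).le]
    push_cast
    ring_nf
  rw [h5] at h3
  simp only [zero_mul, add_zero, Complex.one_cpow, Finset.prod_const_one, mul_one,
    Complex.real_smul] at h3
  have h6 : P.det ^ (-(((N : ℝ) + 1) / 2)) = |LinearMap.det (congruence (CFC.sqrt P))|⁻¹ := by
    rw [mul_comm] at h3
    exact_mod_cast mul_right_cancel₀ hC h3
  rw [Real.rpow_neg hdet.le] at h6
  exact (inv_injective h6).symm

/-- The integrand `exp (- c tr (P⁻¹ X) + i tr (E X))` on the positive semidefinite cone, up to a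
constant the characteristic function integrand of a Wishart distribution. -/
def wishartIntegrand {N : ℕ} (P : Matrix (Fin N) (Fin N) ℝ) (c : ℝ)
    (E : Matrix (Fin N) (Fin N) ℝ) : SymMat N → ℂ :=
  (psdCone N).indicator fun X =>
    Complex.exp (-(c * (P⁻¹ * X.mat).trace : ℝ) + ((E * X.mat).trace : ℝ) * Complex.I)

/-- Substituting `X ↦ √P X √P` reduces the transform to a Laplace integral at a shifted multiple of
the identity. -/
theorem integral_wishartIntegrand {N : ℕ} {P : Matrix (Fin N) (Fin N) ℝ} (hP : P.PosDef)
    {c : ℝ} (hc : 0 < c) (E : Matrix (Fin N) (Fin N) ℝ)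
    (hE : (CFC.sqrt P * E * CFC.sqrt P).IsHermitian) :
    Integrable (wishartIntegrand P c E) ∧ ∫ X, wishartIntegrand P c E X =
      ((siegelConst N * P.det ^ (((N : ℝ) + 1) / 2) : ℝ) : ℂ) *
        ∏ j, ((c : ℂ) - hE.eigenvalues j * Complex.I) ^ (-(((N : ℂ) + 1) / 2)) := by
  have hu := isUnit_sqrt hP
  have hL := det_congruence_ne_zero hu
  obtain ⟨hint, hval⟩ := integral_laplaceIntegrand (α := c) (β := -Complex.I) hE (by simp [hc])
  have hR : CFC.sqrt P * P⁻¹ * CFC.sqrt P = 1 := by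
    have h1 : IsUnit (CFC.sqrt P).det := (Matrix.isUnit_iff_isUnit_det _).mp hu
    have h2 : P⁻¹ = (CFC.sqrt P)⁻¹ * (CFC.sqrt P)⁻¹ := by
      conv_lhs => rw [← sqrt_mul_sqrt hP.posSemidef, Matrix.mul_inv_rev]
    rw [h2, ← mul_assoc, Matrix.mul_nonsing_inv _ h1, one_mul, Matrix.nonsing_inv_mul _ h1]
  have hcomp : ∀ X, wishartIntegrand P c E (congruence (CFC.sqrt P) X) =
      laplaceIntegrand c (-Complex.I) (CFC.sqrt P * E * CFC.sqrt P) X := by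
    intro X
    by_cases hX : X ∈ psdCone N
    · simp only [laplaceIntegrand, wishartIntegrand, Set.indicator_of_mem hX,
        Set.indicator_of_mem ((congruence_mem_psdCone_iff hu).mpr hX)]
      have h1 : ∀ M : Matrix (Fin N) (Fin N) ℝ,
          (M * (congruence (CFC.sqrt P) X).mat).trace =
            (CFC.sqrt P * M * CFC.sqrt P * X.mat).trace := by
        intro M
        rw [mat_congruence, transpose_sqrt, ← mul_assoc, Matrix.trace_mul_comm]
        simp only [mul_assoc]
      rw [h1, h1, hR, one_mul]
      congr 1
      push_cast
      ring
    · simp [laplaceIntegrand, wishartIntegrand, hX, mt (congruence_mem_psdCone_iff hu).mp hX]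
  have h2 := integrable_comp_linearMap_iff volume hL (wishartIntegrand P c E)
  have h3 := integral_comp_linearMap volume hL (wishartIntegrand P c E)
  simp only [hcomp] at h2 h3
  refine ⟨h2.mp hint, ?_⟩
  have hdet : (0 : ℝ) < P.det ^ (((N : ℝ) + 1) / 2) := Real.rpow_pos_of_pos hP.det_pos _
  rw [hval, abs_det_congruence_sqrt hP, Complex.real_smul, Complex.ofReal_inv] at h3
  have hne : ((P.det ^ (((N : ℝ) + 1) / 2) : ℝ) : ℂ) ≠ 0 := Complex.ofReal_ne_zero.mpr hdet.ne'
  rw [eq_inv_mul_iff_mul_eq₀ hne] at h3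
  rw [← h3]
  simp only [sub_eq_add_neg, neg_mul, mul_comm Complex.I]
  push_cast
  ring

end

/-! ### Fourier inversion on the fibres of a linear map -/

noncomputable section

open scoped FourierTransform

theorem normDet_linearEquiv_pos {U W : Type*} [NormedAddCommGroup U] [InnerProductSpace ℝ U]
    [FiniteDimensional ℝ U] [NormedAddCommGroup W] [InnerProductSpace ℝ W] (S : U ≃ₗ[ℝ] W) :
    0 < (S : U →ₗ[ℝ] W).normDet :=
  lt_of_le_of_ne (LinearMap.normDet_nonneg _) (Ne.symm
    (((LinearMap.normDet_ne_zero_tfae (S : U →ₗ[ℝ] W)).out 0 4 rfl rfl).mpr S.injective))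

section changeOfVariables

variable {U W F : Type*} [NormedAddCommGroup U] [InnerProductSpace ℝ U] [FiniteDimensional ℝ U]
  [MeasurableSpace U] [BorelSpace U] [NormedAddCommGroup W] [InnerProductSpace ℝ W]
  [FiniteDimensional ℝ W] [MeasurableSpace W] [BorelSpace W] [NormedAddCommGroup F]

/-- A linear equivalence scales the volume by `LinearMap.normDet`. -/
theorem volume_eq_smul_map_linearEquiv (S : U ≃ₗ[ℝ] W) :
    (volume : Measure W) = ENNReal.ofReal (S : U →ₗ[ℝ] W).normDet • volume.map S := by
  have hS : Measurable S := S.toContinuousLinearEquiv.continuous.measurable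
  ext s hs
  rw [Measure.smul_apply, Measure.map_apply hS hs, smul_eq_mul,
    ← LinearMap.euclideanHausdorffMeasure_image_eq_normDet_mul_volume, S.finrank_eq,
    InnerProductSpace.euclideanHausdorffMeasure_eq_volume]
  congr 1
  exact (Set.image_preimage_eq s S.surjective).symm

theorem integral_eq_normDet_smul [NormedSpace ℝ F] (S : U ≃ₗ[ℝ] W) (f : W → F) :
    ∫ w, f w = (S : U →ₗ[ℝ] W).normDet • ∫ u, f (S u) := by
  have hS : MeasurableEmbedding S := S.toContinuousLinearEquiv.toHomeomorph.measurableEmbedding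
  rw [volume_eq_smul_map_linearEquiv S, integral_smul_measure, hS.integral_map,
    ENNReal.toReal_ofReal (LinearMap.normDet_nonneg _)]

theorem integrable_comp_linearEquiv_iff (S : U ≃ₗ[ℝ] W) (f : W → F) :
    Integrable (fun u => f (S u)) ↔ Integrable f := by
  have hS : MeasurableEmbedding S := S.toContinuousLinearEquiv.toHomeomorph.measurableEmbedding
  rw [volume_eq_smul_map_linearEquiv S, integrable_smul_measure
    (by simpa using normDet_linearEquiv_pos S) ENNReal.ofReal_ne_top, hS.integrable_map_iff]
  rfl

end changeOfVariables

section adjoint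

variable {V : Type*} [NormedAddCommGroup V] [InnerProductSpace ℝ V] [FiniteDimensional ℝ V]
  {m : ℕ} (T : V →ₗ[ℝ] EuclideanSpace ℝ (Fin m))

theorem adjoint_mem_orthogonal_ker (t : EuclideanSpace ℝ (Fin m)) :
    T.adjoint t ∈ (LinearMap.ker T)ᗮ := by
  intro z hz
  rw [LinearMap.adjoint_inner_right, LinearMap.mem_ker.mp hz, inner_zero_left]

theorem adjoint_injective_of_surjective {T : V →ₗ[ℝ] EuclideanSpace ℝ (Fin m)}
    (hT : Function.Surjective T) : Function.Injective T.adjoint := by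
  rw [← LinearMap.ker_eq_bot, LinearMap.ker_eq_bot']
  intro t ht
  obtain ⟨X, rfl⟩ := hT t
  rw [← inner_self_eq_zero (𝕜 := ℝ), ← LinearMap.adjoint_inner_left, ht, inner_zero_left]

/-- The adjoint of a surjective linear map, as an equivalence onto the orthogonal complement of
its kernel. -/
def adjointEquiv {T : V →ₗ[ℝ] EuclideanSpace ℝ (Fin m)} (hT : Function.Surjective T) :
    EuclideanSpace ℝ (Fin m) ≃ₗ[ℝ] (LinearMap.ker T)ᗮ :=
  LinearEquiv.ofInjectiveOfFinrankEq (T.adjoint.codRestrict _ (adjoint_mem_orthogonal_ker T))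
    ((LinearMap.injective_codRestrict_iff _).mpr (adjoint_injective_of_surjective hT)) (by
      have h1 := T.finrank_range_add_finrank_ker
      have h2 := (LinearMap.ker T).finrank_add_finrank_orthogonal
      rw [LinearMap.range_eq_top.mpr hT, finrank_top] at h1
      omega)

theorem coe_adjointEquiv {T : V →ₗ[ℝ] EuclideanSpace ℝ (Fin m)} (hT : Function.Surjective T)
    (t : EuclideanSpace ℝ (Fin m)) : (adjointEquiv hT t : V) = T.adjoint t := rfl

theorem normDet_adjointEquiv {T : V →ₗ[ℝ] EuclideanSpace ℝ (Fin m)}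
    (hT : Function.Surjective T) :
    (adjointEquiv hT : EuclideanSpace ℝ (Fin m) →ₗ[ℝ] (LinearMap.ker T)ᗮ).normDet =
      T.adjoint.normDet :=
  LinearMap.normDet_codRestrict (f := T.adjoint) (adjoint_mem_orthogonal_ker T)

end adjoint

section fiber

variable {V : Type*} [NormedAddCommGroup V] [InnerProductSpace ℝ V] [FiniteDimensional ℝ V]
  [MeasurableSpace V] [BorelSpace V]

theorem measurePreserving_add_orthogonal (K : Submodule ℝ V) :
    MeasurePreserving (fun p : K × Kᗮ => (p.1 : V) + p.2) volume volume := by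
  have h := (K.measurePreserving_measurableEquivProd (0 : V)).symm
  rw [InnerProductSpace.euclideanHausdorffMeasure_eq_volume] at h
  have h2 : ⇑(K.measurableEquivProd (0 : V)).symm = fun p : K × Kᗮ => (p.1 : V) + p.2 := by
    ext1 p
    rw [Submodule.measurableEquivProd_symm_apply, vadd_eq_add, add_zero]
  rwa [h2] at h

theorem integrable_comp_add_orthogonal (K : Submodule ℝ V) {f : V → ℂ} (hf : Integrable f) :
    Integrable (fun p : K × Kᗮ => f ((p.1 : V) + p.2)) := by
  exact (measurePreserving_add_orthogonal K).integrable_comp_of_integrable hf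

/-- Fubini's theorem for a subspace and its orthogonal complement. -/
theorem integral_eq_integral_orthogonal (K : Submodule ℝ V) {f : V → ℂ} (hf : Integrable f) :
    ∫ x, f x = ∫ u : Kᗮ, ∫ z : K, f ((z : V) + u) := by
  have hT := measurePreserving_add_orthogonal K
  have h1 := integrable_comp_add_orthogonal K hf
  have h2 : ∫ x, f x = ∫ p : K × Kᗮ, f ((p.1 : V) + p.2) := by
    conv_lhs => rw [← hT.map_eq]
    rw [integral_map hT.measurable.aemeasurable]
    rw [hT.map_eq]
    exact hf.aestronglyMeasurable
  rw [h2, Measure.volume_eq_prod]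
  rw [Measure.volume_eq_prod] at h1
  exact integral_prod_symm _ h1

variable {m : ℕ}

/-- Fourier inversion for the integral of a function over a fibre of a surjective linear map, as a
function of the base point. The factor `T.adjoint.normDet` is `det (T Tᵀ) ^ (1 / 2)`. -/
theorem integral_fiber_eq {T : V →ₗ[ℝ] EuclideanSpace ℝ (Fin m)} (hT : Function.Surjective T)
    {f : V → ℂ} (hf : Integrable f) (P : V)
    (hcont : ContinuousAt (fun u : (LinearMap.ker T)ᗮ => ∫ z : LinearMap.ker T, f ((z : V) + u))
      ((LinearMap.ker T)ᗮ.orthogonalProjectionOnto P))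
    (hI : Integrable fun t : EuclideanSpace ℝ (Fin m) =>
      ∫ X, f X * Complex.exp ((inner ℝ t (T X) : ℝ) * Complex.I)) :
    ∫ z : LinearMap.ker T, f ((z : V) + P) =
      (((2 * Real.pi) ^ m)⁻¹ * T.adjoint.normDet : ℝ) •
        ∫ t : EuclideanSpace ℝ (Fin m),
          (∫ X, f X * Complex.exp ((inner ℝ t (T X) : ℝ) * Complex.I)) *
            Complex.exp (-((inner ℝ t (T P) : ℝ) * Complex.I)) := by
  set K := LinearMap.ker T with hK
  set I : EuclideanSpace ℝ (Fin m) → ℂ := fun t =>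
    ∫ X, f X * Complex.exp ((inner ℝ t (T X) : ℝ) * Complex.I) with hIdef
  set g : Kᗮ → ℂ := fun u => ∫ z : K, f ((z : V) + u) with hg
  set u₀ : Kᗮ := Kᗮ.orthogonalProjectionOnto P with hu₀
  let S := adjointEquiv hT
  have hsplit : ((K.orthogonalProjectionOnto P : V)) + u₀ = P :=
    K.starProjection_add_starProjection_orthogonal P
  -- `P` and `u₀` lie in the same fibre.
  have hgP : g u₀ = ∫ z : K, f ((z : V) + P) := by
    change ∫ z : K, f ((z : V) + u₀) = _
    rw [← integral_add_right_eq_self (μ := (volume : Measure K)) (fun z : K => f ((z : V) + u₀))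
      (K.orthogonalProjectionOnto P)]
    simp only [Submodule.coe_add, add_assoc, hsplit]
  have hgint : Integrable g := by
    have h1 := integrable_comp_add_orthogonal K hf
    rw [Measure.volume_eq_prod] at h1
    exact h1.integral_prod_right
  have hfour : ∀ w : Kᗮ, 𝓕 g w = ∫ X, f X * Complex.exp
      (((-2 * Real.pi * inner ℝ X (w : V) : ℝ) : ℂ) * Complex.I) := by
    intro w
    rw [Real.fourier_eq']
    have h1 : Integrable fun X => f X * Complex.exp
        (((-2 * Real.pi * inner ℝ X (w : V) : ℝ) : ℂ) * Complex.I) := by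
      refine hf.mul_bdd (c := 1) (Continuous.aestronglyMeasurable (by fun_prop)) ?_
      exact Filter.Eventually.of_forall fun X => (Complex.norm_exp_ofReal_mul_I _).le
    rw [integral_eq_integral_orthogonal K h1]
    congr 1
    ext1 u
    rw [hg, smul_eq_mul, mul_comm, ← integral_mul_const]
    congr 1
    ext1 z
    rw [inner_add_left, w.2 z z.2, zero_add]
    rfl
  -- The transform of the marginal `g` at `Tᵀ τ`, in the normalization `exp (-2π i ⟪·, ·⟫)`.
  have hfourS : ∀ τ, 𝓕 g (S τ) = I ((-2 * Real.pi) • τ) := by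
    intro τ
    rw [hfour, hIdef]
    congr 1
    ext1 X
    rw [coe_adjointEquiv, LinearMap.adjoint_inner_right, inner_smul_left, real_inner_comm]
    simp
  have hFint : Integrable (𝓕 g) := by
    rw [← integrable_comp_linearEquiv_iff S]
    simp only [hfourS]
    exact hI.comp_smul (by simp [Real.pi_ne_zero])
  have hinv := hgint.fourierInv_fourier_eq hFint hcont
  rw [← hgP, ← hinv, Real.fourierInv_eq', integral_eq_normDet_smul S, normDet_adjointEquiv]
  have h2 : ∀ τ, Complex.exp (((2 * Real.pi * inner ℝ (S τ) u₀ : ℝ) : ℂ) * Complex.I) •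
      𝓕 g (S τ) = (fun t => I t * Complex.exp (-((inner ℝ t (T P) : ℝ) * Complex.I)))
        ((-2 * Real.pi) • τ) := by
    intro τ
    have h3 : inner ℝ (S τ) u₀ = inner ℝ τ (T P) := by
      have h4 : inner ℝ (S τ) u₀ = inner ℝ (T.adjoint τ) (u₀ : V) := rfl
      rw [h4, ← hsplit, LinearMap.adjoint_inner_left, map_add,
        LinearMap.mem_ker.mp (K.orthogonalProjectionOnto P).2, zero_add]
    simp only
    rw [hfourS, h3, inner_smul_left, smul_eq_mul, mul_comm]
    congr 2
    simp
  rw [integral_congr_ae (Filter.Eventually.of_forall h2), Measure.integral_comp_smul volume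
    (fun t => I t * Complex.exp (-((inner ℝ t (T P) : ℝ) * Complex.I))) (-2 * Real.pi),
    finrank_euclideanSpace, Fintype.card_fin, smul_smul]
  congr 1
  rw [mul_comm, abs_inv, abs_pow, abs_mul, abs_neg, abs_of_pos Real.pi_pos, abs_of_pos two_pos]

end fiber

end

/-! ### The spectrahedron and the first-order condition at the maximizer -/

noncomputable section

open Filter Topology

/-- Positive definiteness is an open condition, by compactness of the unit sphere. -/
theorem eventually_posDef {N : ℕ} {X : SymMat N} (hX : X.mat.PosDef) :
    ∀ᶠ Y in 𝓝 X, Y.mat.PosDef := by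
  have key : ∀ᶠ Y in 𝓝 X, ∀ x ∈ Metric.sphere (0 : EuclideanSpace ℝ (Fin N)) 1,
      0 < x.ofLp ⬝ᵥ (Y.mat *ᵥ x.ofLp) := by
    refine (isCompact_sphere _ _).eventually_forall_of_forall_eventually fun x hx => ?_
    have hc : Continuous fun p : SymMat N × EuclideanSpace ℝ (Fin N) =>
        p.2.ofLp ⬝ᵥ (p.1.mat *ᵥ p.2.ofLp) := by fun_prop
    refine hc.continuousAt.eventually (lt_mem_nhds ?_)
    refine hX.dotProduct_mulVec_pos fun h0 => ?_
    have : x = 0 := by ext i; exact congrFun h0 i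
    simp [this] at hx
  filter_upwards [key] with Y hY
  rw [Matrix.posDef_iff_dotProduct_mulVec]
  refine ⟨Y.isHermitian_mat, fun {x} hx => ?_⟩
  set y : EuclideanSpace ℝ (Fin N) := WithLp.toLp 2 x
  have hy : y ≠ 0 := fun h => hx (by simpa [y] using h)
  have hpos := hY (‖y‖⁻¹ • y) (by simp [norm_smul, hy])
  have h2 : (‖y‖⁻¹ • y).ofLp = ‖y‖⁻¹ • x := rfl
  rw [h2, Matrix.mulVec_smul, dotProduct_smul, smul_dotProduct, smul_eq_mul, smul_eq_mul] at hpos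
  have h3 : 0 < ‖y‖⁻¹ := by positivity
  simpa [h3] using hpos

/-- First-order condition at a local maximum of the determinant along a line. -/
theorem trace_inv_mul_eq_zero_of_isLocalMax {N : ℕ} {P X : Matrix (Fin N) (Fin N) ℝ}
    (hP : P.PosDef) (h : ∀ᶠ s : ℝ in 𝓝 0, (P + s • X).det ≤ P.det) : (P⁻¹ * X).trace = 0 := by
  have hdet := hP.det_pos
  have hmul : ∀ s : ℝ, (P + s • X).det = P.det * (1 + s • (P⁻¹ * X)).det := by
    intro s
    rw [← Matrix.det_mul, mul_add, mul_one, mul_smul_comm, ← mul_assoc,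
      Matrix.mul_nonsing_inv _ hdet.ne'.isUnit, one_mul]
  set p : Polynomial ℝ :=
    (1 + (Polynomial.X : Polynomial ℝ) • (P⁻¹ * X).map Polynomial.C).det with hp
  have heval : ∀ s : ℝ, p.eval s = (1 + s • (P⁻¹ * X)).det := by
    intro s
    rw [hp, ← Polynomial.coe_evalRingHom, RingHom.map_det]
    congr 1
    generalize P⁻¹ * X = M
    ext i j
    by_cases hij : i = j <;> simp [hij] <;> ring
  have hmax : IsLocalMax (fun s => p.eval s) 0 := by
    filter_upwards [h] with s hs
    rw [heval, heval]
    have h0 : (1 + (0 : ℝ) • (P⁻¹ * X)).det = 1 := by simp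
    rw [h0]
    rw [hmul] at hs
    exact le_of_mul_le_mul_left (by simpa using hs) hdet
  rw [← Matrix.derivative_det_one_add_X_smul]
  exact hmax.hasDerivAt_eq_zero (p.hasDerivAt 0)

section constraints

variable {N m : ℕ} {A : Fin m → SymMat N}

theorem traceMap_apply (M : Fin m → Matrix (Fin N) (Fin N) ℝ) (X : SymMat N) (k : Fin m) :
    traceMap M X k = (M k * X.mat).trace := rfl

theorem inner_traceMap (M : Fin m → Matrix (Fin N) (Fin N) ℝ) (t : EuclideanSpace ℝ (Fin m))
    (X : SymMat N) : inner ℝ t (traceMap M X) = ((∑ k, t k • M k) * X.mat).trace := by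
  rw [Finset.sum_mul, Matrix.trace_sum, PiLp.inner_apply]
  refine Finset.sum_congr rfl fun k _ => ?_
  rw [traceMap_apply, Matrix.smul_mul, Matrix.trace_smul, smul_eq_mul]
  exact mul_comm _ _

theorem mat_sum_smul (A : Fin m → SymMat N) (t : EuclideanSpace ℝ (Fin m)) :
    (∑ k, t k • A k).mat = ∑ k, t k • (A k).mat := by
  rw [← SymMat.matₗ_apply, map_sum]
  simp

theorem adjoint_traceMap (A : Fin m → SymMat N) (t : EuclideanSpace ℝ (Fin m)) :
    (traceMap fun k => (A k).mat).adjoint t = ∑ k, t k • A k := by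
  refine ext_inner_right ℝ fun X => ?_
  rw [LinearMap.adjoint_inner_left, inner_traceMap, SymMat.inner_eq_trace, mat_sum_smul]

theorem surjective_of_adjoint_injective {V W : Type*} [NormedAddCommGroup V]
    [InnerProductSpace ℝ V] [FiniteDimensional ℝ V] [NormedAddCommGroup W] [InnerProductSpace ℝ W]
    [FiniteDimensional ℝ W] {T : V →ₗ[ℝ] W} (h : ∀ t, T.adjoint t = 0 → t = 0) :
    Function.Surjective T := by
  rw [← LinearMap.range_eq_top, ← Submodule.orthogonal_eq_bot_iff, LinearMap.orthogonal_range]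
  exact LinearMap.ker_eq_bot'.mpr h

theorem traceMap_surjective (hA : LinearIndependent ℝ A) :
    Function.Surjective (traceMap fun k => (A k).mat) := by
  refine surjective_of_adjoint_injective fun t ht => ?_
  rw [adjoint_traceMap] at ht
  ext k
  exact Fintype.linearIndependent_iff.mp hA _ ht k

variable {b : Fin m → ℝ} {P : SymMat N}

theorem mem_spectrahedron_iff (hP : P ∈ spectrahedron A b) {X : SymMat N} :
    X ∈ spectrahedron A b ↔
      X ∈ psdCone N ∧ traceMap (fun k => (A k).mat) X = traceMap (fun k => (A k).mat) P := by
  refine and_congr_right fun _ => ⟨fun h => ?_, fun h k => ?_⟩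
  · ext k
    rw [traceMap_apply, traceMap_apply, h k, hP.2 k]
  · rw [← hP.2 k, ← traceMap_apply (fun k => (A k).mat), h, traceMap_apply]

theorem add_mem_spectrahedron_iff (hP : P ∈ spectrahedron A b)
    (z : LinearMap.ker (traceMap fun k => (A k).mat)) :
    (z : SymMat N) + P ∈ spectrahedron A b ↔ (z : SymMat N) + P ∈ psdCone N := by
  rw [mem_spectrahedron_iff hP, map_add, LinearMap.mem_ker.mp z.2, zero_add]
  exact and_iff_left rfl

theorem eventually_line_posDef {P X : SymMat N} (hP : P.mat.PosDef) :
    ∀ᶠ s : ℝ in 𝓝 0, (P + s • X).mat.PosDef := by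
  have hc : ContinuousAt (fun s : ℝ => P + s • X) 0 := by fun_prop
  have h0 : P + (0 : ℝ) • X = P := by simp
  exact hc.eventually (h0.symm ▸ eventually_posDef hP)

/-- The Lagrange condition: `P⁻¹` is orthogonal to the linear space parallel to the
spectrahedron. -/
theorem IsEntropyMaximizer.trace_inv_mul_eq_zero (hP : IsEntropyMaximizer (spectrahedron A b) P)
    (z : LinearMap.ker (traceMap fun k => (A k).mat)) :
    (P.mat⁻¹ * (z : SymMat N).mat).trace = 0 := by
  refine trace_inv_mul_eq_zero_of_isLocalMax hP.posDef ?_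
  filter_upwards [eventually_line_posDef (X := (z : SymMat N)) hP.posDef] with s hs
  have hmem : P + s • (z : SymMat N) ∈ spectrahedron A b := by
    rw [add_comm]
    exact (add_mem_spectrahedron_iff hP.mem (s • z)).mpr
      (by rw [add_comm]; exact hs.posSemidef)
  have hle := hP.le _ hmem hs
  rw [entropy, entropy, add_le_add_iff_left] at hle
  have h2 := le_of_mul_le_mul_left hle (by positivity)
  exact (Real.log_le_log_iff hs.det_pos hP.posDef.det_pos).mp h2

/-- A positive definite point of the spectrahedron is interior relative to the constraints. -/
theorem vectorSpan_spectrahedron (hP : P ∈ spectrahedron A b) (hPd : P.mat.PosDef) :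
    vectorSpan ℝ (spectrahedron A b) = LinearMap.ker (traceMap fun k => (A k).mat) := by
  refine le_antisymm (Submodule.span_le.mpr ?_) fun X hX => ?_
  · rintro _ ⟨Y, hY, Z, hZ, rfl⟩
    change traceMap (fun k => (A k).mat) (Y - Z) = 0
    rw [map_sub,
      ((mem_spectrahedron_iff hP).mp hY).2, ((mem_spectrahedron_iff hP).mp hZ).2, sub_self]
  · have h1 : ∀ᶠ s : ℝ in 𝓝[≠] 0, (P + s • X).mat.PosDef :=
      (eventually_line_posDef hPd).filter_mono nhdsWithin_le_nhds
    obtain ⟨s, hs, hs0⟩ := (h1.and self_mem_nhdsWithin).exists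
    have hmem : s • X + P ∈ spectrahedron A b :=
      (add_mem_spectrahedron_iff hP (s • (⟨X, hX⟩ : LinearMap.ker _))).mpr (by
        change s • X + P ∈ psdCone N
        rw [add_comm]
        exact hs.posSemidef)
    have h2 : s • X ∈ vectorSpan ℝ (spectrahedron A b) := by
      simpa using vsub_mem_vectorSpan ℝ hmem hP
    simpa [smul_smul, inv_mul_cancel₀ hs0] using Submodule.smul_mem _ s⁻¹ h2

theorem euclideanHausdorffMeasure_spectrahedron (hP : P ∈ spectrahedron A b) {d : ℕ}
    (hd : Module.finrank ℝ (LinearMap.ker (traceMap fun k => (A k).mat)) = d) :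
    (μHE[d] : Measure (SymMat N)) (spectrahedron A b) =
      volume {z : LinearMap.ker (traceMap fun k => (A k).mat) |
        (z : SymMat N) + P ∈ psdCone N} := by
  have hiso : Isometry fun z : LinearMap.ker (traceMap fun k => (A k).mat) =>
      (z : SymMat N) + P := Isometry.of_dist_eq fun x y => by
    rw [dist_add_right]
    rfl
  rw [← InnerProductSpace.euclideanHausdorffMeasure_eq_volume, hd,
    ← hiso.euclideanHausdorffMeasure_image]
  congr 1
  ext X
  constructor
  · intro hX
    have hX' := (mem_spectrahedron_iff hP).mp hX
    exact ⟨⟨X - P, by rw [LinearMap.mem_ker, map_sub, hX'.2, sub_self]⟩,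
      by simpa using hX'.1, by simp⟩
  · rintro ⟨z, hz, rfl⟩
    exact (add_mem_spectrahedron_iff hP z).mpr hz

theorem wishartIntegrand_zero_of_mem {P : Matrix (Fin N) (Fin N) ℝ} {c : ℝ} {X : SymMat N}
    (hX : X ∈ psdCone N) :
    wishartIntegrand P c 0 X = (Real.exp (-(c * (P⁻¹ * X.mat).trace)) : ℝ) := by
  rw [wishartIntegrand, Set.indicator_of_mem hX]
  simp

/-- On the spectrahedron the Wishart density is constant, so its integral is a multiple of the
volume. -/
theorem integral_wishartIntegrand_ker (hP : IsEntropyMaximizer (spectrahedron A b) P)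
    {d : ℕ} (hd : Module.finrank ℝ (LinearMap.ker (traceMap fun k => (A k).mat)) = d) (c : ℝ) :
    ∫ z : LinearMap.ker (traceMap fun k => (A k).mat),
        wishartIntegrand P.mat c 0 ((z : SymMat N) + P) =
      (Real.exp (-(c * N)) * frobeniusVolume d (spectrahedron A b) : ℝ) := by
  have hset : MeasurableSet {z : LinearMap.ker (traceMap fun k => (A k).mat) |
      (z : SymMat N) + P ∈ psdCone N} :=
    ((isClosed_psdCone N).preimage (by fun_prop)).measurableSet
  have hpt : (fun z : LinearMap.ker (traceMap fun k => (A k).mat) =>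
      wishartIntegrand P.mat c 0 ((z : SymMat N) + P)) =
      {z : LinearMap.ker (traceMap fun k => (A k).mat) |
        (z : SymMat N) + P ∈ psdCone N}.indicator fun _ => ((Real.exp (-(c * N)) : ℝ) : ℂ) := by
    ext1 z
    by_cases hz : (z : SymMat N) + P ∈ psdCone N
    · rw [wishartIntegrand_zero_of_mem hz, Set.indicator_of_mem (by exact hz), SymMat.mat_add,
        mul_add, Matrix.trace_add, hP.trace_inv_mul_eq_zero z,
        Matrix.nonsing_inv_mul _ hP.posDef.det_pos.ne'.isUnit]
      simp
    · rw [wishartIntegrand, Set.indicator_of_notMem hz, Set.indicator_of_notMem (by exact hz)]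
  rw [hpt, integral_indicator_const _ hset, frobeniusVolume,
    euclideanHausdorffMeasure_spectrahedron hP.mem hd, measureReal_def]
  rw [Complex.real_smul, mul_comm]
  push_cast
  rfl

end constraints

end

/-! ### Continuity of the fibre integral at the maximizer -/

noncomputable section

open Filter Topology

theorem add_mem_psdCone {N : ℕ} {X Y : SymMat N} (hX : X ∈ psdCone N) (hY : Y ∈ psdCone N) :
    X + Y ∈ psdCone N :=
  Matrix.PosSemidef.add hX hY

theorem smul_mem_psdCone {N : ℕ} {X : SymMat N} {s : ℝ} (hs : 0 ≤ s) (hX : X ∈ psdCone N) :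
    s • X ∈ psdCone N :=
  Matrix.PosSemidef.smul hX hs

/-- Without constraints the spectrahedron is a cone, hence not compact. -/
theorem one_le_of_isCompact_spectrahedron {N m : ℕ} {A : Fin m → SymMat N} {b : Fin m → ℝ}
    (hcompact : IsCompact (spectrahedron A b)) (hN : 1 ≤ N) {P : SymMat N}
    (hP : P ∈ spectrahedron A b) (hPd : P.mat.PosDef) : 1 ≤ m := by
  by_contra hm
  obtain rfl : m = 0 := by omega
  have hP0 : P ≠ 0 := by
    rintro rfl
    have := hPd.diag_pos (i := (⟨0, hN⟩ : Fin N))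
    exact lt_irrefl _ this
  obtain ⟨R, hR⟩ := hcompact.isBounded.exists_norm_le
  have hmem : ((|R| + 1) * ‖P‖⁻¹) • P ∈ spectrahedron A b :=
    ⟨smul_mem_psdCone (by positivity) hP.1, fun k => k.elim0⟩
  have h1 := hR _ hmem
  rw [norm_smul, Real.norm_of_nonneg (by positivity), mul_assoc,
    inv_mul_cancel₀ (norm_ne_zero_iff.mpr hP0)] at h1
  linarith [le_abs_self R]

section continuity

variable {N m : ℕ} {A : Fin m → SymMat N} {b : Fin m → ℝ} {P : SymMat N}

theorem measurable_wishartIntegrand (P : Matrix (Fin N) (Fin N) ℝ) (c : ℝ)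
    (E : Matrix (Fin N) (Fin N) ℝ) : Measurable (wishartIntegrand P c E) := by
  refine Measurable.indicator ?_ (isClosed_psdCone N).measurableSet
  exact Continuous.measurable (by fun_prop)

/-- A point of a section of the cone that is interior to the section, relative to a positive
definite point of the section, is positive definite. -/
theorem posDef_of_mem_interior {K : Submodule ℝ (SymMat N)} {u : SymMat N} {p z : K}
    (hp : ((p : SymMat N) + u).mat.PosDef)
    (hz : z ∈ interior {z : K | (z : SymMat N) + u ∈ psdCone N}) :
    ((z : SymMat N) + u).mat.PosDef := by
  have hc : ContinuousAt (fun s : ℝ => z + s • (z - p)) 0 := by fun_prop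
  have h0 : {z : K | (z : SymMat N) + u ∈ psdCone N} ∈ 𝓝 (z + (0 : ℝ) • (z - p)) := by
    rw [zero_smul, add_zero]
    exact mem_interior_iff_mem_nhds.mp hz
  have h1 : ∀ᶠ s : ℝ in 𝓝 0, z + s • (z - p) ∈ {z : K | (z : SymMat N) + u ∈ psdCone N} :=
    hc.eventually_mem h0
  have h2 : ∀ᶠ s : ℝ in 𝓝[>] 0, z + s • (z - p) ∈ {z : K | (z : SymMat N) + u ∈ psdCone N} :=
    h1.filter_mono nhdsWithin_le_nhds
  -- `z` lies strictly between `p` and a point of the section beyond `z`.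
  obtain ⟨s, hs, hs0⟩ := (h2.and self_mem_nhdsWithin).exists
  have hs0 : 0 < s := hs0
  have hs' : (z : SymMat N) + s • ((z : SymMat N) - p) + u ∈ psdCone N := hs
  have h3 : (1 + s) • ((z : SymMat N) + u) =
      s • ((p : SymMat N) + u) + ((z : SymMat N) + s • ((z : SymMat N) - p) + u) := by module
  have h4 : ((1 + s) • ((z : SymMat N) + u)).mat.PosDef := by
    rw [h3, SymMat.mat_add, SymMat.mat_smul]
    exact (hp.smul hs0).add_posSemidef hs'
  have h5 : (z : SymMat N) + u = (1 + s)⁻¹ • ((1 + s) • ((z : SymMat N) + u)) := by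
    rw [smul_smul, inv_mul_cancel₀ (by positivity), one_smul]
  rw [h5, SymMat.mat_smul]
  exact h4.smul (by positivity)

/-- If `u` lies in the fibre of the spectrahedron, then the section of the cone through `u + P` is
bounded. -/
theorem isBounded_section (hcompact : IsCompact (spectrahedron A b))
    (hP : P ∈ spectrahedron A b) (u : SymMat N)
    (hu : traceMap (fun k => (A k).mat) u = traceMap (fun k => (A k).mat) P) :
    Bornology.IsBounded {z : LinearMap.ker (traceMap fun k => (A k).mat) |
      (z : SymMat N) + u + P ∈ psdCone N} := by
  obtain ⟨R, hR⟩ := hcompact.isBounded.exists_norm_le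
  refine isBounded_iff_forall_norm_le.mpr ⟨2 * R + ‖u + P‖, fun z hz => ?_⟩
  -- The section through `u + P` is the spectrahedron scaled by `2`.
  have hmem : (2⁻¹ : ℝ) • ((z : SymMat N) + u + P) ∈ spectrahedron A b := by
    refine (mem_spectrahedron_iff hP).mpr ⟨smul_mem_psdCone (by norm_num) hz, ?_⟩
    rw [map_smul, map_add, map_add, LinearMap.mem_ker.mp z.2, hu, zero_add, ← two_smul ℝ,
      smul_smul, inv_mul_cancel₀ two_ne_zero, one_smul]
  have h1 := hR _ hmem
  rw [norm_smul, Real.norm_of_nonneg (by norm_num)] at h1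
  have h2 : (z : SymMat N) = ((z : SymMat N) + u + P) - (u + P) := by abel
  have h3 : ‖z‖ = ‖(z : SymMat N)‖ := rfl
  rw [h3, h2]
  linarith [norm_sub_le ((z : SymMat N) + u + P) (u + P)]

theorem continuousAt_wishartIntegrand_of_posDef (Q : Matrix (Fin N) (Fin N) ℝ) (c : ℝ)
    {X : SymMat N} (hX : X.mat.PosDef) : ContinuousAt (wishartIntegrand Q c 0) X := by
  have h : wishartIntegrand Q c 0 =ᶠ[𝓝 X] fun X =>
      ((Real.exp (-(c * (Q⁻¹ * X.mat).trace)) : ℝ) : ℂ) := by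
    filter_upwards [eventually_posDef hX] with Y hY
    exact wishartIntegrand_zero_of_mem hY.posSemidef
  refine ContinuousAt.congr ?_ h.symm
  exact Continuous.continuousAt (by fun_prop)

theorem continuousAt_wishartIntegrand_of_notMem (Q : Matrix (Fin N) (Fin N) ℝ) (c : ℝ)
    {X : SymMat N} (hX : X ∉ psdCone N) : ContinuousAt (wishartIntegrand Q c 0) X := by
  have h : wishartIntegrand Q c 0 =ᶠ[𝓝 X] fun _ => 0 := by
    filter_upwards [(isClosed_psdCone N).isOpen_compl.mem_nhds hX] with Y hY
    exact Set.indicator_of_notMem hY _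
  exact continuousAt_const.congr h.symm

/-- The integral of the Wishart density over the fibres of the constraint map is continuous at the
fibre of the maximizer: the integrand is continuous off the boundary of a convex section, and the
nearby sections are uniformly bounded. -/
theorem continuousAt_integral_wishartIntegrand (hcompact : IsCompact (spectrahedron A b))
    (hP : IsEntropyMaximizer (spectrahedron A b) P) (c : ℝ) :
    ContinuousAt (fun u : (LinearMap.ker (traceMap fun k => (A k).mat))ᗮ =>
      ∫ z : LinearMap.ker (traceMap fun k => (A k).mat),
        wishartIntegrand P.mat c 0 ((z : SymMat N) + u))
      ((LinearMap.ker (traceMap fun k => (A k).mat))ᗮ.orthogonalProjectionOnto P) := by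
  set T : SymMat N →ₗ[ℝ] EuclideanSpace ℝ (Fin m) := traceMap fun k => (A k).mat with hT
  set K := LinearMap.ker T with hK
  set u₀ : Kᗮ := Kᗮ.orthogonalProjectionOnto P with hu₀
  set p : K := K.orthogonalProjectionOnto P with hp
  have hsplit : (p : SymMat N) + u₀ = P := K.starProjection_add_starProjection_orthogonal P
  have hTu : T u₀ = T P := by
    rw [← hsplit, map_add, LinearMap.mem_ker.mp p.2, zero_add]
  -- `D` contains all sections near `u₀`, as `P + u₀ - u` is positive semidefinite for `u` near
  -- `u₀`.
  set D : Set K := {z : K | (z : SymMat N) + u₀ + P ∈ psdCone N} with hD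
  have hDclosed : IsClosed D := (isClosed_psdCone N).preimage (by fun_prop)
  have hDfin : volume D < ⊤ :=
    (isBounded_section hcompact hP.mem (u₀ : SymMat N) hTu).measure_lt_top
  set B : ℝ := Real.exp (-(c * (P.mat⁻¹ * (u₀ : SymMat N).mat).trace)) + 1 with hB
  have hnear1 : ∀ᶠ u : Kᗮ in 𝓝 u₀, P + u₀ - u ∈ psdCone N := by
    have hc : ContinuousAt (fun u : Kᗮ => P + u₀ - (u : SymMat N)) u₀ := by fun_prop
    have h0 : P + u₀ - (u₀ : SymMat N) = P := by abel
    filter_upwards [hc.eventually (h0.symm ▸ eventually_posDef hP.posDef)] with u hu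
    exact hu.posSemidef
  have hnear2 : ∀ᶠ u : Kᗮ in 𝓝 u₀,
      Real.exp (-(c * (P.mat⁻¹ * (u : SymMat N).mat).trace)) < B := by
    have hc : Continuous fun u : Kᗮ =>
        Real.exp (-(c * (P.mat⁻¹ * (u : SymMat N).mat).trace)) := by fun_prop
    exact hc.continuousAt.eventually (gt_mem_nhds (lt_add_one _))
  refine continuousAt_of_dominated (bound := D.indicator fun _ => B) ?_ ?_ ?_ ?_
  · exact Eventually.of_forall fun u =>
      ((measurable_wishartIntegrand P.mat c 0).comp
        (by fun_prop : Continuous fun z : K => (z : SymMat N) + u).measurable).aestronglyMeasurable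
  · filter_upwards [hnear1, hnear2] with u hu1 hu2
    refine Eventually.of_forall fun z => ?_
    by_cases hz : (z : SymMat N) + u ∈ psdCone N
    · have hzD : z ∈ D := by
        have := add_mem_psdCone hz hu1
        have h2 : (z : SymMat N) + u + (P + u₀ - u) = (z : SymMat N) + u₀ + P := by abel
        rwa [h2] at this
      rw [Set.indicator_of_mem hzD, wishartIntegrand_zero_of_mem hz, SymMat.mat_add, mul_add,
        Matrix.trace_add, hP.trace_inv_mul_eq_zero z, zero_add, Complex.norm_real,
        Real.norm_of_nonneg (Real.exp_pos _).le]
      exact hu2.le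
    · rw [wishartIntegrand, Set.indicator_of_notMem hz, norm_zero]
      exact Set.indicator_nonneg (fun _ _ => by positivity) _
  · exact (integrable_indicator_iff hDclosed.measurableSet).mpr
      (integrableOn_const hDfin.ne)
  · set C : Set K := {z : K | (z : SymMat N) + u₀ ∈ psdCone N} with hC
    have hCconv : Convex ℝ C := by
      have := (convex_psdCone N).translate_preimage_left (u₀ : SymMat N)
      exact this.linear_preimage K.subtype
    have hfr : ∀ᵐ z : K, z ∉ frontier C :=
      measure_eq_zero_iff_ae_notMem.mp (hCconv.addHaar_frontier volume)
    filter_upwards [hfr] with z hz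
    have hcomp : ContinuousAt (wishartIntegrand P.mat c 0) ((z : SymMat N) + u₀) := by
      by_cases hzC : z ∈ C
      · have hint : z ∈ interior C := by
          by_contra h
          exact hz ⟨subset_closure hzC, h⟩
        exact continuousAt_wishartIntegrand_of_posDef _ _
          (posDef_of_mem_interior (p := p) (by rw [hsplit]; exact hP.posDef) hint)
      · exact continuousAt_wishartIntegrand_of_notMem _ _ hzC
    exact ContinuousAt.comp (f := fun u : Kᗮ => (z : SymMat N) + u) hcomp (by fun_prop)

end continuity

end

/-! ### From the pointwise bound to the integral -/

noncomputable section

open Filter Topology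

theorem lintegral_error_le_mul_lintegral_exp_neg {E : Type*} [NormedAddCommGroup E]
    [NormedSpace ℝ E] [FiniteDimensional ℝ E] [MeasurableSpace E] [BorelSpace E] [Nontrivial E]
    (μ : Measure E) [μ.IsAddHaarMeasure] {q : E → ℝ} (hq : Continuous q)
    (hqs : ∀ (s : ℝ) u, q (s • u) = s ^ 2 * q u) {lam θ ε : ℝ} (hθ : 0 < θ) (hε : 0 < ε)
    (hε' : ε ≤ 1 / 2) (hlam : ∀ t, lam * ‖t‖ ^ 2 ≤ q t)
    (hk : 16 * (Module.finrank ℝ E : ℝ) ^ 3 ≤ ε ^ 2 * (lam / θ ^ 2)) :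
    ∫⁻ t, ENNReal.ofReal (2 * (θ * ‖t‖) * q t *
        (1 + (θ * ‖t‖) ^ 2) ^ (-(q t / (θ * ‖t‖) ^ 2))) ∂μ ≤
      ENNReal.ofReal ε * ∫⁻ t, ENNReal.ofReal (Real.exp (-q t)) ∂μ := by
  refine lintegral_le_mul_lintegral_of_rays μ (by fun_prop) (by fun_prop) _ fun u hu => ?_
  have hqu : lam ≤ q u := by simpa [hu] using hlam u
  have hray := lintegral_ray_error_le (m := Module.finrank ℝ E) Module.finrank_pos hθ hε hε'
    (k := q u) (hk.trans (by gcongr))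
  convert hray using 1
  · refine setLIntegral_congr_fun measurableSet_Ioi fun s hs => ?_
    have hs : (0 : ℝ) < s := hs
    rw [hqs, norm_smul, hu, mul_one, Real.norm_of_nonneg hs.le, mul_comm (s ^ 2)]
  · congr 1
    refine setLIntegral_congr_fun measurableSet_Ioi fun s _ => ?_
    rw [hqs, mul_comm (s ^ 2)]

theorem integrable_exp_neg_of_sq_norm_le {E : Type*} [NormedAddCommGroup E]
    [InnerProductSpace ℝ E] [FiniteDimensional ℝ E] [MeasurableSpace E] [BorelSpace E]
    {q : E → ℝ} (hq : Continuous q) {lam : ℝ} (h0 : 0 < lam) (hlam : ∀ t, lam * ‖t‖ ^ 2 ≤ q t) :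
    Integrable fun t => Real.exp (-q t) := by
  have h1 : Integrable fun t : E => Real.exp (-lam * ‖t‖ ^ 2) := by
    have := GaussianFourier.integrable_cexp_neg_mul_sq_norm_add (V := E) (b := lam)
      (by simpa using h0) 0 0
    refine (this.norm).congr (Eventually.of_forall fun t => ?_)
    simp only [Complex.norm_exp]
    congr 1
    simp [← Complex.ofReal_pow]
  refine h1.mono' (by fun_prop) (Eventually.of_forall fun t => ?_)
  rw [Real.norm_of_nonneg (Real.exp_pos _).le]
  exact Real.exp_le_exp.mpr (by linarith [hlam t])

/-- A function that is close to a Gaussian in the sense of the pointwise bound has nearly the same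
integral as the Gaussian. -/
theorem integral_sub_integral_exp_neg_le {E : Type*} [NormedAddCommGroup E]
    [InnerProductSpace ℝ E] [FiniteDimensional ℝ E] [MeasurableSpace E] [BorelSpace E]
    [Nontrivial E] {q : E → ℝ} (hq : Continuous q)
    (hqs : ∀ (s : ℝ) u, q (s • u) = s ^ 2 * q u) {lam θ ε : ℝ} (h0 : 0 < lam) (hθ : 0 < θ)
    (hε : 0 < ε) (hε' : ε ≤ 1 / 2) (hlam : ∀ t, lam * ‖t‖ ^ 2 ≤ q t)
    (hk : 16 * (Module.finrank ℝ E : ℝ) ^ 3 ≤ ε ^ 2 * (lam / θ ^ 2))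
    {G : E → ℂ} (hG : AEStronglyMeasurable G)
    (hGq : ∀ t ≠ 0, ‖G t - Complex.exp (-(q t : ℂ))‖ ≤ 2 * (θ * ‖t‖) * q t *
        (1 + (θ * ‖t‖) ^ 2) ^ (-(q t / (θ * ‖t‖) ^ 2))) :
    Integrable G ∧ ‖(∫ t, G t) - (∫ t, Real.exp (-q t) : ℝ)‖ ≤ ε * ∫ t, Real.exp (-q t) := by
  have hint := integrable_exp_neg_of_sq_norm_le hq h0 hlam
  have hcexp : ∀ t, Complex.exp (-(q t : ℂ)) = ((Real.exp (-q t) : ℝ) : ℂ) := fun t => by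
    push_cast
    rfl
  have hintC : Integrable fun t => Complex.exp (-(q t : ℂ)) := by
    simp only [hcexp]
    exact hint.ofReal
  have hlin : ∫⁻ t, ‖G t - Complex.exp (-(q t : ℂ))‖ₑ ≤
      ENNReal.ofReal (ε * ∫ t, Real.exp (-q t)) := by
    rw [ENNReal.ofReal_mul hε.le, ofReal_integral_eq_lintegral_ofReal hint
      (Eventually.of_forall fun t => (Real.exp_pos _).le)]
    refine le_trans (lintegral_mono_ae ?_)
      (lintegral_error_le_mul_lintegral_exp_neg volume hq hqs hθ hε hε' hlam hk)
    have hne : ∀ᵐ t : E, t ≠ 0 := by simp [ae_iff]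
    filter_upwards [hne] with t ht
    rw [← ofReal_norm]
    exact ENNReal.ofReal_le_ofReal (hGq t ht)
  have hsub : Integrable fun t => G t - Complex.exp (-(q t : ℂ)) :=
    ⟨hG.sub hintC.aestronglyMeasurable, hlin.trans_lt ENNReal.ofReal_lt_top⟩
  have hGint : Integrable G := by
    refine (hsub.add hintC).congr (Eventually.of_forall fun t => ?_)
    exact sub_add_cancel _ _
  refine ⟨hGint, ?_⟩
  have h1 : ((∫ t, Real.exp (-q t) : ℝ) : ℂ) = ∫ t, Complex.exp (-(q t : ℂ)) := by
    simp only [hcexp]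
    exact integral_ofReal.symm
  rw [h1, ← integral_sub hGint hintC]
  refine (norm_integral_le_lintegral_norm _).trans ?_
  refine ENNReal.toReal_le_of_le_ofReal
    (mul_nonneg hε.le (integral_nonneg fun t => (Real.exp_pos _).le)) ?_
  simpa only [ofReal_norm] using hlin

section spectral

variable {n : Type*} [Fintype n] [DecidableEq n] {W : Matrix n n ℝ}

theorem sum_eigenvalues (hW : W.IsHermitian) : ∑ j, hW.eigenvalues j = W.trace := by
  simpa using hW.trace_eq_sum_eigenvalues.symm

theorem sum_eigenvalues_sq (hW : W.IsHermitian) :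
    ∑ j, hW.eigenvalues j ^ 2 = (W ^ 2).trace := by
  conv_rhs => rw [hW.spectral_theorem, ← map_pow, Unitary.conjStarAlgAut_apply,
    Matrix.trace_mul_cycle, Unitary.coe_star_mul_self, one_mul, Matrix.diagonal_pow,
    Matrix.trace_diagonal]
  simp

theorem eigenvalue_eq_dotProduct (hW : W.IsHermitian) (j : n) :
    hW.eigenvalues j =
      (hW.eigenvectorBasis j).ofLp ⬝ᵥ (W *ᵥ (hW.eigenvectorBasis j).ofLp) := by
  simpa using hW.eigenvalues_eq j

end spectral

end

/-! ### The transform in terms of the eigenvalues of the pencil -/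

noncomputable section

open Filter Topology

section transform

variable {N m : ℕ} (A : Fin m → SymMat N) (P : SymMat N)

/-- The symmetric matrices `√P A_k √P`. -/
def conjConstraintSym (k : Fin m) : SymMat N := congruence (CFC.sqrt P.mat) (A k)

theorem mat_conjConstraintSym (k : Fin m) :
    (conjConstraintSym A P k).mat = conjConstraint A P k := by
  rw [conjConstraintSym, mat_congruence, transpose_sqrt, conjConstraint]

theorem traceMap_conjConstraint :
    traceMap (conjConstraint A P) = traceMap fun k => (conjConstraintSym A P k).mat := by
  simp only [mat_conjConstraintSym]

theorem sum_conjConstraint (t : EuclideanSpace ℝ (Fin m)) :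
    CFC.sqrt P.mat * (∑ k, t k • (A k).mat) * CFC.sqrt P.mat = ∑ k, t k • conjConstraint A P k := by
  rw [Finset.mul_sum, Finset.sum_mul]
  exact Finset.sum_congr rfl fun k _ => by rw [conjConstraint, mul_smul_comm, smul_mul_assoc]

theorem adjoint_traceMap_conjConstraint (t : EuclideanSpace ℝ (Fin m)) :
    ((traceMap (conjConstraint A P)).adjoint t).mat = ∑ k, t k • conjConstraint A P k := by
  rw [traceMap_conjConstraint, adjoint_traceMap, mat_sum_smul]
  simp only [mat_conjConstraintSym]

theorem isHermitian_sum_conjConstraint (t : EuclideanSpace ℝ (Fin m)) :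
    (∑ k, t k • conjConstraint A P k).IsHermitian := by
  rw [← adjoint_traceMap_conjConstraint]
  exact SymMat.isHermitian_mat _

theorem quadForm_eq_norm_sq (t : EuclideanSpace ℝ (Fin m)) :
    quadForm (conjConstraint A P) t =
      1 / ((N : ℝ) + 1) * ‖(traceMap (conjConstraint A P)).adjoint t‖ ^ 2 := by
  rw [quadForm, ← real_inner_self_eq_norm_sq, SymMat.inner_eq_trace,
    adjoint_traceMap_conjConstraint, sq]

theorem continuous_quadForm : Continuous (quadForm (conjConstraint A P)) := by
  have h : Continuous (traceMap (conjConstraint A P)).adjoint :=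
    LinearMap.continuous_of_finiteDimensional _
  have h2 : quadForm (conjConstraint A P) = fun t =>
      1 / ((N : ℝ) + 1) * ‖(traceMap (conjConstraint A P)).adjoint t‖ ^ 2 :=
    funext (quadForm_eq_norm_sq A P)
  rw [h2]
  fun_prop

theorem quadForm_smul (s : ℝ) (t : EuclideanSpace ℝ (Fin m)) :
    quadForm (conjConstraint A P) (s • t) = s ^ 2 * quadForm (conjConstraint A P) t := by
  rw [quadForm_eq_norm_sq, quadForm_eq_norm_sq, map_smul, norm_smul, mul_pow, Real.norm_eq_abs,
    sq_abs]
  ring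

/-- The eigenvalues of `∑ t_k Z_k` are controlled by the numerical range of the tuple `Z`. -/
theorem abs_eigenvalue_le {θ : ℝ}
    (hA2 : ∀ x : EuclideanSpace ℝ (Fin N), ‖x‖ = 1 →
      2 / ((N : ℝ) + 1) *
        ‖(WithLp.toLp 2 fun k => x.ofLp ⬝ᵥ (conjConstraint A P k *ᵥ x.ofLp) :
          EuclideanSpace ℝ (Fin m))‖ ≤ θ) (t : EuclideanSpace ℝ (Fin m)) (j : Fin N) :
    |(isHermitian_sum_conjConstraint A P t).eigenvalues j / (((N : ℝ) + 1) / 2)| ≤ θ * ‖t‖ := by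
  set hW := isHermitian_sum_conjConstraint A P t
  set x := hW.eigenvectorBasis j
  set w : EuclideanSpace ℝ (Fin m) :=
    WithLp.toLp 2 fun k => x.ofLp ⬝ᵥ (conjConstraint A P k *ᵥ x.ofLp) with hw
  have h1 : hW.eigenvalues j = inner ℝ w t := by
    rw [eigenvalue_eq_dotProduct, PiLp.inner_apply, Matrix.sum_mulVec, dotProduct_sum]
    refine Finset.sum_congr rfl fun k _ => ?_
    rw [Matrix.smul_mulVec, dotProduct_smul]
    rfl
  have h2 := hA2 x (hW.eigenvectorBasis.orthonormal.norm_eq_one j)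
  have hN : (0 : ℝ) < ((N : ℝ) + 1) / 2 := by positivity
  rw [abs_div, abs_of_pos hN, h1, div_le_iff₀ hN]
  have h3 : ‖w‖ ≤ θ * (((N : ℝ) + 1) / 2) := by
    rw [← div_le_iff₀ hN]
    calc ‖w‖ / (((N : ℝ) + 1) / 2) = 2 / ((N : ℝ) + 1) * ‖w‖ := by field_simp
      _ ≤ θ := h2
  calc |inner ℝ w t| ≤ ‖w‖ * ‖t‖ := abs_real_inner_le_norm w t
    _ ≤ θ * (((N : ℝ) + 1) / 2) * ‖t‖ := by gcongr
    _ = θ * ‖t‖ * (((N : ℝ) + 1) / 2) := by ring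

variable {P}

theorem trace_sum_conjConstraint (hP : P.mat.PosDef) (t : EuclideanSpace ℝ (Fin m)) :
    (∑ k, t k • conjConstraint A P k).trace =
      inner ℝ t (traceMap (fun k => (A k).mat) P) := by
  rw [inner_traceMap, ← sum_conjConstraint, Matrix.trace_mul_comm, ← mul_assoc,
    sqrt_mul_sqrt hP.posSemidef, Matrix.trace_mul_comm]

theorem wishartIntegrand_mul_cexp (Q : Matrix (Fin N) (Fin N) ℝ) (c : ℝ)
    (t : EuclideanSpace ℝ (Fin m)) (X : SymMat N) :
    wishartIntegrand Q c 0 X *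
        Complex.exp ((inner ℝ t (traceMap (fun k => (A k).mat) X) : ℝ) * Complex.I) =
      wishartIntegrand Q c (∑ k, t k • (A k).mat) X := by
  by_cases hX : X ∈ psdCone N
  · rw [wishartIntegrand, wishartIntegrand, Set.indicator_of_mem hX, Set.indicator_of_mem hX,
      ← Complex.exp_add, inner_traceMap]
    simp
  · rw [wishartIntegrand, wishartIntegrand, Set.indicator_of_notMem hX,
      Set.indicator_of_notMem hX, zero_mul]

/-- The closed form of the total mass `∫ exp (- (N + 1) / 2 * tr (P⁻¹ X)) dX` over the cone. -/
def wishartMass (P : SymMat N) : ℝ :=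
  siegelConst N * P.mat.det ^ (((N : ℝ) + 1) / 2) *
    ((((N : ℝ) + 1) / 2) ^ (-(((N : ℝ) + 1) / 2))) ^ N

theorem wishartMass_pos (hP : P.mat.PosDef) : 0 < wishartMass P := by
  have := siegelConst_pos N
  have := hP.det_pos
  unfold wishartMass
  positivity

theorem exp_entropy (hP : P.mat.PosDef) :
    Real.exp (entropy P) = Real.exp (((N : ℝ) + 1) / 2 * N) * wishartMass P := by
  have hc : (0 : ℝ) < ((N : ℝ) + 1) / 2 := by positivity
  have h1 : Real.log (((N : ℝ) + 1) / (2 * Real.exp 1)) = Real.log (((N : ℝ) + 1) / 2) - 1 := by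
    rw [← div_div, Real.log_div hc.ne' (Real.exp_pos 1).ne', Real.log_exp]
  rw [entropy, h1, wishartMass, ← siegelConst, Real.exp_add, Real.exp_sub,
    Real.exp_log (siegelConst_pos N), Real.rpow_def_of_pos hP.det_pos, Real.rpow_def_of_pos hc,
    ← Real.exp_nat_mul, mul_comm (Real.log P.mat.det), div_eq_mul_inv, ← Real.exp_neg]
  have h2 : Real.exp (-((N : ℝ) * (N + 1) / 2 * (Real.log (((N : ℝ) + 1) / 2) - 1))) =
      Real.exp (((N : ℝ) + 1) / 2 * N) *
        Real.exp (N * (Real.log (((N : ℝ) + 1) / 2) * -(((N : ℝ) + 1) / 2))) := by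
    rw [← Real.exp_add]
    congr 1
    ring
  rw [h2]
  ring

theorem integrable_wishartIntegrand_zero (hP : P.mat.PosDef) :
    Integrable (wishartIntegrand P.mat (((N : ℝ) + 1) / 2) 0) :=
  (integral_wishartIntegrand hP (by positivity) 0 (by simp)).1

/-- The Fourier transform of the Wishart density along the constraints, in terms of the
eigenvalues of `∑ t_k Z_k`. -/
theorem integral_wishartIntegrand_mul_cexp (hP : P.mat.PosDef) (t : EuclideanSpace ℝ (Fin m)) :
    ∫ X, wishartIntegrand P.mat (((N : ℝ) + 1) / 2) 0 X *
        Complex.exp ((inner ℝ t (traceMap (fun k => (A k).mat) X) : ℝ) * Complex.I) =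
      wishartMass P * ∏ j, (1 - ((isHermitian_sum_conjConstraint A P t).eigenvalues j /
        (((N : ℝ) + 1) / 2) : ℝ) * Complex.I) ^ (-((((N : ℝ) + 1) / 2 : ℝ) : ℂ)) := by
  have hc : (0 : ℝ) < ((N : ℝ) + 1) / 2 := by positivity
  set c : ℝ := ((N : ℝ) + 1) / 2 with hcdef
  have hE : (CFC.sqrt P.mat * (∑ k, t k • (A k).mat) * CFC.sqrt P.mat).IsHermitian := by
    rw [sum_conjConstraint]
    exact isHermitian_sum_conjConstraint A P t
  have heig : hE.eigenvalues = (isHermitian_sum_conjConstraint A P t).eigenvalues := by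
    congr 1
    exact sum_conjConstraint A P t
  simp only [wishartIntegrand_mul_cexp]
  rw [(integral_wishartIntegrand hP hc _ hE).2, heig, wishartMass, ← hcdef]
  have hcC : ((N : ℂ) + 1) / 2 = (c : ℂ) := by
    rw [hcdef]
    push_cast
    rfl
  rw [hcC]
  have hfac : ∀ ν : ℝ, ((c : ℂ) - ν * Complex.I) ^ (-(c : ℂ)) =
      ((c ^ (-c) : ℝ) : ℂ) * (1 - (ν / c : ℝ) * Complex.I) ^ (-(c : ℂ)) := by
    intro ν
    have hne : (1 - (ν / c : ℝ) * Complex.I : ℂ) ≠ 0 := by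
      intro h
      have := congrArg Complex.re h
      simp at this
    rw [Complex.ofReal_cpow hc.le, Complex.ofReal_neg, ← ofReal_mul_cpow hc hne]
    congr 1
    have : (c : ℂ) ≠ 0 := Complex.ofReal_ne_zero.mpr hc.ne'
    push_cast
    field_simp
  simp only [hfac, Finset.prod_mul_distrib, Finset.prod_const, Finset.card_univ, Fintype.card_fin]
  push_cast
  ring

/-- The Fourier transform, recentred at `P` and normalized, is close to a Gaussian. -/
theorem norm_wishart_transform_sub_le (hP : P.mat.PosDef) {θ : ℝ} (hθ : 0 < θ)
    (hA2 : ∀ x : EuclideanSpace ℝ (Fin N), ‖x‖ = 1 →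
      2 / ((N : ℝ) + 1) *
        ‖(WithLp.toLp 2 fun k => x.ofLp ⬝ᵥ (conjConstraint A P k *ᵥ x.ofLp) :
          EuclideanSpace ℝ (Fin m))‖ ≤ θ) {t : EuclideanSpace ℝ (Fin m)} (ht : t ≠ 0) :
    ‖(wishartMass P : ℂ)⁻¹ * ((∫ X, wishartIntegrand P.mat (((N : ℝ) + 1) / 2) 0 X *
        Complex.exp ((inner ℝ t (traceMap (fun k => (A k).mat) X) : ℝ) * Complex.I)) *
        Complex.exp (-((inner ℝ t (traceMap (fun k => (A k).mat) P) : ℝ) * Complex.I))) -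
      Complex.exp (-(quadForm (conjConstraint A P) t : ℂ))‖ ≤
    2 * (θ * ‖t‖) * quadForm (conjConstraint A P) t *
      (1 + (θ * ‖t‖) ^ 2) ^ (-(quadForm (conjConstraint A P) t / (θ * ‖t‖) ^ 2)) := by
  have hc : (0 : ℝ) < ((N : ℝ) + 1) / 2 := by positivity
  have hr : 0 < θ * ‖t‖ := mul_pos hθ (norm_pos_iff.mpr ht)
  have hM : (wishartMass P : ℂ) ≠ 0 := Complex.ofReal_ne_zero.mpr (wishartMass_pos hP).ne'
  have h := norm_prod_cpow_mul_exp_sub_le hc hr (abs_eigenvalue_le A P hA2 t)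
  have h1 : ((N : ℝ) + 1) / 2 / 2 * ∑ j, ((isHermitian_sum_conjConstraint A P t).eigenvalues j /
      (((N : ℝ) + 1) / 2)) ^ 2 = quadForm (conjConstraint A P) t := by
    simp only [div_pow, ← Finset.sum_div]
    rw [sum_eigenvalues_sq, quadForm]
    field_simp
  have h2 : ((N : ℝ) + 1) / 2 * ∑ j, (isHermitian_sum_conjConstraint A P t).eigenvalues j /
      (((N : ℝ) + 1) / 2) = inner ℝ t (traceMap (fun k => (A k).mat) P) := by
    rw [← Finset.sum_div, sum_eigenvalues, trace_sum_conjConstraint A hP, mul_div_cancel₀ _ hc.ne']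
  rw [h1, h2] at h
  rw [integral_wishartIntegrand_mul_cexp A hP, mul_assoc (wishartMass P : ℂ),
    inv_mul_cancel_left₀ hM, ← neg_mul]
  exact h

end transform

end

/-! ### The Gaussian integral and the approximate volume -/

noncomputable section

open Filter Topology

theorem gramDet_eq_normDet_sq {N m : ℕ} (T : SymMat N →ₗ[ℝ] EuclideanSpace ℝ (Fin m)) :
    gramDet T = T.adjoint.normDet ^ 2 := by
  have h := LinearMap.normDet_sq T.adjoint
  rw [LinearMap.adjoint_adjoint] at h
  exact_mod_cast h.symm

theorem normDet_adjoint_pos {N m : ℕ} {T : SymMat N →ₗ[ℝ] EuclideanSpace ℝ (Fin m)}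
    (hT : Function.Surjective T) : 0 < T.adjoint.normDet := by
  rw [← normDet_adjointEquiv hT]
  exact normDet_linearEquiv_pos _

/-- A Gaussian integral for the quadratic form `‖Tᵀ t‖²`. -/
theorem normDet_mul_integral_exp_neg {N m : ℕ} {T : SymMat N →ₗ[ℝ] EuclideanSpace ℝ (Fin m)}
    (hT : Function.Surjective T) {a : ℝ} (ha : 0 < a) :
    T.adjoint.normDet * ∫ t, Real.exp (-(a * ‖T.adjoint t‖ ^ 2)) =
      (Real.pi / a) ^ ((m : ℝ) / 2) := by
  have h := integral_eq_normDet_smul (adjointEquiv hT) fun w => Real.exp (-a * ‖w‖ ^ 2)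
  rw [GaussianFourier.integral_rexp_neg_mul_sq_norm ha, normDet_adjointEquiv,
    ← (adjointEquiv hT).finrank_eq, finrank_euclideanSpace, Fintype.card_fin, smul_eq_mul] at h
  rw [h]
  congr 2
  ext1 t
  rw [neg_mul]
  rfl

/-- The approximate volume expressed through the Gaussian integral of `quadForm`: this is the
Fourier inversion formula for the volume with the transform replaced by the Gaussian. -/
theorem volumeApprox_eq {N m : ℕ} (A : Fin m → SymMat N) {P : SymMat N} (hP : P.mat.PosDef)
    (hT : Function.Surjective (traceMap fun k => (A k).mat))
    (hB : Function.Surjective (traceMap (conjConstraint A P))) :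
    volumeApprox A P = Real.exp (((N : ℝ) + 1) / 2 * N) * (((2 * Real.pi) ^ m)⁻¹ *
      (traceMap fun k => (A k).mat).adjoint.normDet) * (wishartMass P *
        ∫ t, Real.exp (-quadForm (conjConstraint A P) t)) := by
  have hN : (0 : ℝ) < (N : ℝ) + 1 := by positivity
  have hDA := normDet_adjoint_pos hT
  have hDB := normDet_adjoint_pos hB
  have hJ := normDet_mul_integral_exp_neg hB (one_div_pos.mpr hN)
  simp only [← quadForm_eq_norm_sq] at hJ
  have hJ' : ∫ t, Real.exp (-quadForm (conjConstraint A P) t) =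
      (Real.pi / (1 / ((N : ℝ) + 1))) ^ ((m : ℝ) / 2) /
        (traceMap (conjConstraint A P)).adjoint.normDet := by
    rw [eq_div_iff hDB.ne', mul_comm]
    exact hJ
  have hpow : (Real.pi / (1 / ((N : ℝ) + 1))) ^ ((m : ℝ) / 2) =
      (2 * Real.pi) ^ m * (((N : ℝ) + 1) / (4 * Real.pi)) ^ ((m : ℝ) / 2) := by
    have h1 : (2 * Real.pi) ^ m = ((2 * Real.pi) ^ 2) ^ ((m : ℝ) / 2) := by
      rw [← Real.rpow_natCast, ← Real.rpow_natCast, ← Real.rpow_mul (by positivity)]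
      congr 1
      push_cast
      ring
    rw [h1, ← Real.mul_rpow (by positivity) (by positivity)]
    congr 1
    field_simp
    ring
  rw [volumeApprox, gramDet_eq_normDet_sq, gramDet_eq_normDet_sq, ← div_pow, ← Real.sqrt_eq_rpow,
    Real.sqrt_sq (by positivity), exp_entropy hP, hJ', hpow]
  have hpi : (2 * Real.pi) ^ m ≠ 0 := by positivity
  field_simp

theorem conjConstraint_surjective {N m : ℕ} {A : Fin m → SymMat N} {P : SymMat N} {lam : ℝ}
    (hlam : 0 < lam) (hA1 : ∀ t : EuclideanSpace ℝ (Fin m),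
      lam * ‖t‖ ^ 2 ≤ quadForm (conjConstraint A P) t) :
    Function.Surjective (traceMap (conjConstraint A P)) := by
  refine surjective_of_adjoint_injective fun t ht => ?_
  have h := hA1 t
  rw [quadForm_eq_norm_sq, ht, norm_zero] at h
  by_contra h0
  have := mul_pos hlam (pow_pos (norm_pos_iff.mpr h0) 2)
  norm_num at h
  linarith

/-- The part of the lower bound on `lam` that the comparison of integrals needs. -/
theorem sixteen_mul_pow_three_le {N m : ℕ} (hN : 2 ≤ N) {lam θ ε : ℝ} (hθ : 0 < θ)
    (hε : 0 < ε) (hε' : ε ≤ 1 / 2)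
    (hA3 : 10 ^ 5 * θ ^ 2 * (ε⁻¹) ^ 2 * m * (m + Real.log ε⁻¹) ^ 2 * Real.log (N * ε⁻¹) ≤ lam) :
    16 * (m : ℝ) ^ 3 ≤ ε ^ 2 * (lam / θ ^ 2) := by
  have hε2 : (2 : ℝ) ≤ ε⁻¹ := by
    rw [le_inv_comm₀ (by norm_num) hε]
    linarith
  have hN' : (2 : ℝ) ≤ N := by exact_mod_cast hN
  have hlog1 : 0 ≤ Real.log ε⁻¹ := Real.log_nonneg (by linarith)
  have hlog2 : 1 ≤ Real.log (N * ε⁻¹) := by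
    rw [Real.le_log_iff_exp_le (by positivity)]
    have := Real.exp_one_lt_d9
    nlinarith
  have hm0 : (0 : ℝ) ≤ m := Nat.cast_nonneg m
  have h1 : (m : ℝ) ^ 2 ≤ (m + Real.log ε⁻¹) ^ 2 := by gcongr; linarith
  have h2 : 10 ^ 5 * θ ^ 2 * (ε⁻¹) ^ 2 * m * (m : ℝ) ^ 2 * 1 ≤ lam := le_trans (by gcongr) hA3
  have h3 : ε ^ 2 * (10 ^ 5 * θ ^ 2 * (ε⁻¹) ^ 2 * m * (m : ℝ) ^ 2 * 1 / θ ^ 2) =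
      10 ^ 5 * (m : ℝ) ^ 3 := by
    field_simp
  calc 16 * (m : ℝ) ^ 3 ≤ 10 ^ 5 * (m : ℝ) ^ 3 := by gcongr; norm_num
    _ = _ := h3.symm
    _ ≤ _ := by gcongr

theorem aestronglyMeasurable_transform {N m : ℕ} (Q : Matrix (Fin N) (Fin N) ℝ) (c : ℝ)
    (T : SymMat N →ₗ[ℝ] EuclideanSpace ℝ (Fin m)) :
    AEStronglyMeasurable fun t : EuclideanSpace ℝ (Fin m) =>
      ∫ X, wishartIntegrand Q c 0 X * Complex.exp ((inner ℝ t (T X) : ℝ) * Complex.I) := by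
  refine StronglyMeasurable.aestronglyMeasurable (StronglyMeasurable.integral_prod_right
    (f := fun (t : EuclideanSpace ℝ (Fin m)) X =>
      wishartIntegrand Q c 0 X * Complex.exp ((inner ℝ t (T X) : ℝ) * Complex.I)) ?_)
  refine Measurable.stronglyMeasurable ?_
  have hT : Continuous T := LinearMap.continuous_of_finiteDimensional _
  refine ((measurable_wishartIntegrand Q c 0).comp measurable_snd).mul (Continuous.measurable ?_)
  fun_prop

end

end SpectrahedronVolume

open SpectrahedronVolume in
theorem theorem7p1 {N m : ℕ} (A : Fin m → SymMat N) (b : Fin m → ℝ)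
    (hcompact : IsCompact (spectrahedron A b))
    (hindep : LinearIndependent ℝ A)
    (hm : m < (N + 1).choose 2)
    (hdim : Module.finrank ℝ (vectorSpan ℝ (spectrahedron A b)) = (N + 1).choose 2 - m)
    (P : SymMat N) (hP : IsEntropyMaximizer (spectrahedron A b) P)
    (lam θ ε : ℝ) (hlam : 0 < lam) (hθ : 0 < θ) (hε : 0 < ε) (hε' : ε ≤ 1 / 2)
    (hA1 : ∀ t : EuclideanSpace ℝ (Fin m),
      lam * ‖t‖ ^ 2 ≤ quadForm (conjConstraint A P) t)
    (hA2 : ∀ x : EuclideanSpace ℝ (Fin N), ‖x‖ = 1 →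
      2 / ((N : ℝ) + 1) *
        ‖(WithLp.toLp 2 fun k => x.ofLp ⬝ᵥ (conjConstraint A P k *ᵥ x.ofLp) :
          EuclideanSpace ℝ (Fin m))‖ ≤ θ)
    (hA3 : 10 ^ 5 * θ ^ 2 * (ε⁻¹) ^ 2 * m * (m + Real.log ε⁻¹) ^ 2 * Real.log (N * ε⁻¹) ≤ lam) :
    0 < volumeApprox A P ∧
      |frobeniusVolume ((N + 1).choose 2 - m) (spectrahedron A b) / volumeApprox A P - 1| ≤ ε := by
  have hN1 : 1 ≤ N := by
    rcases N with _ | N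
    · simp at hm
    · omega
  -- Compactness excludes `m = 0`, and then `m < N (N + 1) / 2` excludes `N = 1`.
  have hm1 : 1 ≤ m := one_le_of_isCompact_spectrahedron hcompact hN1 hP.mem hP.posDef
  have hN2 : 2 ≤ N := by
    by_contra h
    obtain rfl : N = 1 := by omega
    norm_num at hm
    omega
  have hT := traceMap_surjective hindep
  have hB := conjConstraint_surjective hlam hA1
  rw [vectorSpan_spectrahedron hP.mem hP.posDef] at hdim
  have : Nontrivial (EuclideanSpace ℝ (Fin m)) := by
    have : Nonempty (Fin m) := ⟨⟨0, hm1⟩⟩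
    infer_instance
  set c : ℝ := ((N : ℝ) + 1) / 2 with hc
  set T := traceMap fun k => (A k).mat with hTdef
  set q := quadForm (conjConstraint A P) with hq
  set J : ℝ := ∫ t, Real.exp (-q t) with hJ
  -- The transform of the Wishart density, recentred at `P` and normalized to `1` at `t = 0`.
  let G : EuclideanSpace ℝ (Fin m) → ℂ := fun t => (wishartMass P : ℂ)⁻¹ *
    ((∫ X, wishartIntegrand P.mat c 0 X * Complex.exp ((inner ℝ t (T X) : ℝ) * Complex.I)) *
      Complex.exp (-((inner ℝ t (T P) : ℝ) * Complex.I)))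
  have hM := wishartMass_pos hP.posDef
  have hMC : (wishartMass P : ℂ) ≠ 0 := Complex.ofReal_ne_zero.mpr hM.ne'
  have hGmeas : AEStronglyMeasurable G := by
    refine AEStronglyMeasurable.const_mul ((aestronglyMeasurable_transform P.mat c T).mul ?_) _
    exact Continuous.aestronglyMeasurable (by fun_prop)
  obtain ⟨hGint, hGJ⟩ := integral_sub_integral_exp_neg_le (continuous_quadForm A P)
    (quadForm_smul A P) hlam hθ hε hε' hA1
    (by simpa using sixteen_mul_pow_three_le hN2 hθ hε hε' hA3) hGmeas
    (fun t ht => norm_wishart_transform_sub_le A hP.posDef hθ hA2 ht)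
  have hJpos : 0 < J := integral_exp_pos
    (integrable_exp_neg_of_sq_norm_le (continuous_quadForm A P) hlam hA1)
  have hI : Integrable fun t : EuclideanSpace ℝ (Fin m) =>
      ∫ X, wishartIntegrand P.mat c 0 X * Complex.exp ((inner ℝ t (T X) : ℝ) * Complex.I) := by
    have h1 : Integrable fun t : EuclideanSpace ℝ (Fin m) => (wishartMass P : ℂ) * (G t *
        Complex.exp ((inner ℝ t (T P) : ℝ) * Complex.I)) := by
      refine Integrable.const_mul (hGint.mul_bdd (c := 1)
        (Continuous.aestronglyMeasurable (by fun_prop)) ?_) _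
      exact Filter.Eventually.of_forall fun t => (Complex.norm_exp_ofReal_mul_I _).le
    refine h1.congr (Filter.Eventually.of_forall fun t => ?_)
    simp only [G]
    rw [Complex.exp_neg]
    rw [mul_assoc (wishartMass P : ℂ)⁻¹, mul_inv_cancel_left₀ hMC, mul_assoc,
      inv_mul_cancel₀ (Complex.exp_ne_zero _), mul_one]
  have hfib := integral_fiber_eq hT (integrable_wishartIntegrand_zero hP.posDef) P
    (continuousAt_integral_wishartIntegrand hcompact hP c) hI
  have hGI : ∫ t : EuclideanSpace ℝ (Fin m),
      (∫ X, wishartIntegrand P.mat c 0 X * Complex.exp ((inner ℝ t (T X) : ℝ) * Complex.I)) *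
        Complex.exp (-((inner ℝ t (T P) : ℝ) * Complex.I)) = wishartMass P * ∫ t, G t := by
    rw [← integral_const_mul]
    refine integral_congr_ae (Filter.Eventually.of_forall fun t => ?_)
    exact (mul_inv_cancel_left₀ hMC _).symm
  rw [integral_wishartIntegrand_ker hP hdim, hGI] at hfib
  set vol := frobeniusVolume ((N + 1).choose 2 - m) (spectrahedron A b) with hvol
  set D : ℝ := ((2 * Real.pi) ^ m)⁻¹ * T.adjoint.normDet with hD
  have hDpos : 0 < D := by
    have := normDet_adjoint_pos hT
    have := Real.pi_pos
    positivity
  have hV : volumeApprox A P = Real.exp (c * N) * D * (wishartMass P * J) :=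
    volumeApprox_eq A hP.posDef hT hB
  have hVpos : 0 < volumeApprox A P := by
    rw [hV]
    positivity
  refine ⟨hVpos, ?_⟩
  have hGvol : ∫ t, G t = ((vol / (Real.exp (c * N) * D * wishartMass P) : ℝ) : ℂ) := by
    have hE : ((Real.exp (-(c * N)) : ℝ) : ℂ) = ((Real.exp (c * N) : ℝ) : ℂ)⁻¹ := by
      rw [Real.exp_neg, Complex.ofReal_inv]
    have hE0 : ((Real.exp (c * N) : ℝ) : ℂ) ≠ 0 :=
      Complex.ofReal_ne_zero.mpr (Real.exp_pos _).ne'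
    have hD0 : (D : ℂ) ≠ 0 := Complex.ofReal_ne_zero.mpr hDpos.ne'
    rw [Complex.real_smul, Complex.ofReal_mul, hE] at hfib
    rw [Complex.ofReal_div, Complex.ofReal_mul, Complex.ofReal_mul,
      eq_div_iff (mul_ne_zero (mul_ne_zero hE0 hD0) hMC)]
    rw [inv_mul_eq_iff_eq_mul₀ hE0] at hfib
    rw [hfib]
    ring
  rw [hGvol, ← Complex.ofReal_sub, Complex.norm_real, Real.norm_eq_abs] at hGJ
  have hfin : vol / volumeApprox A P - 1 =
      (vol / (Real.exp (c * N) * D * wishartMass P) - J) / J := by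
    rw [hV]
    field_simp
  rw [hfin, abs_div, abs_of_pos hJpos, div_le_iff₀ hJpos]
  exact hGJ
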